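/- Let $(T,\Sigma,\mu)$ be a finite measure space (agents), let $(\Omega,\mathscr F,\nu)$ be a complete probability space (states of nature), and let $\ell\in\mathbb N$. Let $a:T\times\Omega\to\mathbb R^\ell_+$ (endowments) and $U:T\times\Omega\times\mathbb R^\ell_+\to\mathbb R$ (utilities) satisfy: (A1) $a$ is jointly measurable, and for each $\omega\in\Omega$ the function $a(\cdot,\omega)$ is $\mu$-integrable and every coordinate of $\int_T a(\cdot,\omega)\,d\mu$ is strictly positive. (A2) $U(\cdot,\cdot,x)$ is jointly measurable on $T\times\Omega$ for every $x\in\mathbb R^\ell_+$, and $U(t,\omega,\cdot)$ is continuous for every $(t,\omega)\in T\times\Omega$. (A3) For all $(t,\omega)\in T\times\Omega$ and $x,y\in\mathbb R^\ell_+$ with $y\neq 0$, $U(t,\omega,x+y)>U(t,\omega,x)$. Let $\Delta=\{p\in\mathbb R^\ell: p^h>0 \text{ for all } h,\ \sum_{h=1}^\ell p^h=1\}$. For $(t,\omega,p)\in T\times\Omega\times\Delta$ put $$B(t,\omega,p)=\{x\in\mathbb R^\ell_+:\langle p,x\rangle\le\langle p,a(t,\omega)\rangle\},$$ $$C(t,\omega,p)=\{y\in\mathbb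 R^\ell_+: U(t,\omega,y)\ge U(t,\omega,x)\text{ for all }x\in B(t,\omega,p)\},$$ $$X(t,\omega,p)=\Big\{x\in\mathbb R^\ell_+: x^k\le \frac{1}{\min_h p^h}\sum_{h=1}^\ell a^h(t,\omega)\ \text{for all } k\Big\},$$ and $C^X(t,\omega,p)=C(t,\omega,p)\cap X(t,\omega,p)$. Let $$\int_T C^X(\cdot,\omega,p)\,d\mu=\Big\{\int_T f\,d\mu : f:T\to\mathbb R^\ell \text{ is } \mu\text{-integrable and } f(t)\in C^X(t,\omega,p)\text{ for } \mu\text{-almost all } t\Big\}$$ be the Aumann integral. Let $\mathscr K_0(\mathbb R^\ell_+)$ be the space of non-empty compact subsets of $\mathbb R^\ell_+$ with the Hausdorff metric and its Borel $\sigma$-algebra. Then $\int_T C^X(\cdot,\omega,p)\,d\mu\in\mathscr K_0(\mathbb R^\ell_+)$ for all $(\omega,p)\in\Omega\times\Delta$, and the map $$\Phi:\Omega\times\Delta\to\mathscr K_0(\mathbb R^\ell_+),\qquad \Phi(\omega,p)=\int_T C^X(\cdot,\omega,p)\,d\mu,$$ is jointly measurable, that is, measurable with respect to $\mathscr F\otimes\mathfrak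 B(\Delta)$. It is moreover a Carathéodory map: $\Phi(\cdot,p)$ is $\mathscr F$-measurable for each $p\in\Delta$, and $\Phi(\omega,\cdot)$ is continuous for each $\omega\in\Omega$. -/

import Mathlib

open MeasureTheory

/-- The nonnegative orthant of `ℓ`-dimensional Euclidean space: the consumption set. -/
def orthant (ℓ : ℕ) : AddSubmonoid (EuclideanSpace ℝ (Fin ℓ)) where
  carrier := {x | ∀ h, 0 ≤ x h}
  zero_mem' := fun _ => le_rfl
  add_mem' := fun hx hy h => add_nonneg (hx h) (hy h)

/-- Strictly positive price vectors whose coordinates sum to one. -/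
abbrev PriceSimplex (ℓ : ℕ) : Type :=
  {p : EuclideanSpace ℝ (Fin ℓ) // (∀ h, 0 < p h) ∧ ∑ h, p h = 1}

/-- The space of non-empty compact subsets of the orthant. Mathlib's metric on `NonemptyCompacts`
is the Hausdorff metric. -/
abbrev CompactSubsets (ℓ : ℕ) : Type :=
  TopologicalSpace.NonemptyCompacts (orthant ℓ)

/-- The Borel σ-algebra of the Hausdorff metric topology. -/
instance compactSubsetsMeasurableSpace (ℓ : ℕ) : MeasurableSpace (CompactSubsets ℓ) :=
  borel (CompactSubsets ℓ)

/-- A function of two variables that is measurable in the first and continuous in the second. -/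
def IsCaratheodory {S M Y : Type*} [MeasurableSpace S] [TopologicalSpace M]
    [TopologicalSpace Y] [MeasurableSpace Y] (f : S × M → Y) : Prop :=
  (∀ x : M, Measurable fun s : S => f (s, x)) ∧ ∀ s : S, Continuous fun x : M => f (s, x)

/-- The Aumann integral: the set of integrals of all integrable a.e. selections. -/
noncomputable def aumannIntegral {T : Type*} [MeasurableSpace T] {ℓ : ℕ} (μ : Measure T)
    (F : T → Set (EuclideanSpace ℝ (Fin ℓ))) : Set (EuclideanSpace ℝ (Fin ℓ)) :=
  {v | ∃ f : T → EuclideanSpace ℝ (Fin ℓ),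
    Integrable f μ ∧ (∀ᵐ t ∂μ, f t ∈ F t) ∧ ∫ t, f t ∂μ = v}

/-- Endowments are jointly measurable, and in every state the aggregate endowment is a
(finite) vector all of whose coordinates are strictly positive. -/
def AssumptionA1 {T Ω : Type*} [MeasurableSpace T] [MeasurableSpace Ω] {ℓ : ℕ} (μ : Measure T)
    (a : T → Ω → orthant ℓ) : Prop :=
  (Measurable fun z : T × Ω => a z.1 z.2) ∧
    ∀ ω, Integrable (fun t => (a t ω : EuclideanSpace ℝ (Fin ℓ))) μ ∧
      ∀ h, 0 < (∫ t, (a t ω : EuclideanSpace ℝ (Fin ℓ)) ∂μ) h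

/-- Utilities are jointly measurable in (agent, state) and continuous in consumption. -/
def AssumptionA2 {T Ω : Type*} [MeasurableSpace T] [MeasurableSpace Ω] {ℓ : ℕ}
    (U : T → Ω → orthant ℓ → ℝ) : Prop :=
  (∀ x, Measurable fun z : T × Ω => U z.1 z.2 x) ∧ ∀ t ω, Continuous (U t ω)

/-- Utilities are strictly monotone. -/
def AssumptionA3 {T Ω : Type*} {ℓ : ℕ} (U : T → Ω → orthant ℓ → ℝ) : Prop :=
  ∀ t ω, ∀ x y : orthant ℓ, y ≠ 0 → U t ω x < U t ω (x + y)

/-- The budget set `B(t, ω, p)`. -/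
def budgetSet {T Ω : Type*} {ℓ : ℕ} (a : T → Ω → orthant ℓ) (t : T) (ω : Ω)
    (p : PriceSimplex ℓ) : Set (orthant ℓ) :=
  {x | inner ℝ (p : EuclideanSpace ℝ (Fin ℓ)) (x : EuclideanSpace ℝ (Fin ℓ)) ≤
    inner ℝ (p : EuclideanSpace ℝ (Fin ℓ)) (a t ω : EuclideanSpace ℝ (Fin ℓ))}

/-- `δ(p)`, the smallest coordinate of `p` (the price simplex is empty for `ℓ = 0`). -/
noncomputable def minPrice {ℓ : ℕ} (p : PriceSimplex ℓ) : ℝ :=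
  ⨅ h : Fin ℓ, (p : EuclideanSpace ℝ (Fin ℓ)) h

/-- The vector `b(t, ω, p)` with all coordinates equal to `γ(t, ω, p) = (∑ₕ aʰ(t, ω)) / δ(p)`. -/
noncomputable def boundVector {T Ω : Type*} {ℓ : ℕ} (a : T → Ω → orthant ℓ) (t : T) (ω : Ω)
    (p : PriceSimplex ℓ) : EuclideanSpace ℝ (Fin ℓ) :=
  WithLp.toLp 2 fun _ => (1 / minPrice p) * ∑ h, (a t ω : EuclideanSpace ℝ (Fin ℓ)) h

/-- The box `X(t, ω, p)` of consumption bundles below `b(t, ω, p)`. -/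
def boxSet {T Ω : Type*} {ℓ : ℕ} (a : T → Ω → orthant ℓ) (t : T) (ω : Ω)
    (p : PriceSimplex ℓ) : Set (orthant ℓ) :=
  {x | ∀ h, (x : EuclideanSpace ℝ (Fin ℓ)) h ≤ boundVector a t ω p h}

/-- `C(t, ω, p)`: the bundles at least as good as everything in the budget set. -/
def upperSet {T Ω : Type*} {ℓ : ℕ} (a : T → Ω → orthant ℓ) (U : T → Ω → orthant ℓ → ℝ)
    (t : T) (ω : Ω) (p : PriceSimplex ℓ) : Set (orthant ℓ) :=
  {y | ∀ x ∈ budgetSet a t ω p, U t ω x ≤ U t ω y}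

/-- The preferred set `C^X(t, ω, p) = C(t, ω, p) ∩ X(t, ω, p)`. -/
def preferredSet {T Ω : Type*} {ℓ : ℕ} (a : T → Ω → orthant ℓ) (U : T → Ω → orthant ℓ → ℝ)
    (t : T) (ω : Ω) (p : PriceSimplex ℓ) : Set (orthant ℓ) :=
  upperSet a U t ω p ∩ boxSet a t ω p

/-- The aggregate preferred set `∫_T C^X(·, ω, p) dμ`, as a subset of Euclidean space. -/
noncomputable def aggregatePreferredSet {T Ω : Type*} [MeasurableSpace T] {ℓ : ℕ} (μ : Measure T)
    (a : T → Ω → orthant ℓ) (U : T → Ω → orthant ℓ → ℝ) (ω : Ω) (p : PriceSimplex ℓ) :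
    Set (EuclideanSpace ℝ (Fin ℓ)) :=
  aumannIntegral μ fun t => (fun x : orthant ℓ => (x : EuclideanSpace ℝ (Fin ℓ))) ''
    preferredSet a U t ω p

/-! An agent is an endowment together with a continuous strictly monotone utility, viewed as a point
of a second countable pseudometrizable space (compact-open topology on utilities). The data `a`, `U`
become one measurable map from `T × Ω` into this space, and everything rests on one sequential
continuity statement, `EconomyTendsto.tendsto_compactAggregate`: if economies converge pointwise
with integrably dominated wealth, and prices converge, then the aggregate preferred sets converge in
the Hausdorff metric.

Upper hemicontinuity is a Fatou lemma in several dimensions, `exists_cluster_integral`: a limit of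
integrals of dominated functions is the integral of a function whose values are pointwise cluster
points. Since preferred sets have closed graph, that function is a selection for the limit economy.
The measure may have atoms. The Fatou lemma is obtained by cutting the range at countably many
rational levels; at each cut a conditional probability is replaced by a set with Lyapunov's theorem,
and on an atom there is nothing to replace because weak limits of indicators remain extreme there.
For lower hemicontinuity a selection is pushed slightly towards the upper corner of the box; by
strict monotonicity it becomes strictly better than the budget set, which survives small
perturbations of the agent and of the price.

Continuity in the price is the case of a constant economy. For measurability in the state, economies
whose dependence on the state factors through a countable set are trivial; all measurable economies
arise from these by iterated pointwise limits, and the continuity statement carries measurability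
along after endowments are truncated. Joint measurability then follows from the Carathéodory
property. -/

open Filter Topology Set

/-! ### Weak compactness of order intervals in L² and weak limits along filters. -/

section WeakCompactness

variable {T : Type*} [MeasurableSpace T] {μ : Measure T}

/-- The square-integrable functions between two bounds, as functionals in the weak dual. -/
def l2OrderInterval (μ : Measure T) (l u : T → ℝ) : Set (WeakDual ℝ (Lp ℝ 2 μ)) :=
  {φ | ∃ g : Lp ℝ 2 μ, (∀ᵐ t ∂μ, l t ≤ g t ∧ g t ≤ u t) ∧ ∀ k : Lp ℝ 2 μ, φ k = inner ℝ k g}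

lemma ae_between_of_setIntegral {g l u : T → ℝ} (hg : Integrable g μ) (hl : Integrable l μ)
    (hu : Integrable u μ)
    (h : ∀ A, MeasurableSet A → ∫ t in A, l t ∂μ ≤ ∫ t in A, g t ∂μ ∧
      ∫ t in A, g t ∂μ ≤ ∫ t in A, u t ∂μ) :
    ∀ᵐ t ∂μ, l t ≤ g t ∧ g t ≤ u t := by
  filter_upwards [ae_le_of_forall_setIntegral_le hl hg fun s hs _ => (h s hs).1,
    ae_le_of_forall_setIntegral_le hg hu fun s hs _ => (h s hs).2] with t h1 h2
  exact ⟨h1, h2⟩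

variable [IsFiniteMeasure μ]

lemma integrable_l2 (g : Lp ℝ 2 μ) : Integrable g μ :=
  (Lp.memLp g).integrable one_le_two

/-- Banach–Alaoglu: the interval is norm bounded, and testing against indicators turns its pointwise
a.e. bounds into weak-* closed conditions. Riesz representation recovers a function from a
functional satisfying them. -/
lemma isCompact_l2OrderInterval {l u : T → ℝ} (hl : Integrable l μ) (hu : Integrable u μ)
    {R : ℝ} (hR : ∀ t, -R ≤ l t ∧ u t ≤ R) : IsCompact (l2OrderInterval μ l u) := by
  obtain ⟨r, hr⟩ : ∃ r : ℝ, ∀ g : Lp ℝ 2 μ, (∀ᵐ t ∂μ, l t ≤ g t ∧ g t ≤ u t) → ‖g‖ ≤ r := by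
    refine ⟨_, fun g hg => Lp.norm_le_of_ae_bound (C := |R|) (abs_nonneg _) ?_⟩
    filter_upwards [hg] with t ht
    rw [Real.norm_eq_abs]
    exact (abs_le.2 ⟨(hR t).1.trans ht.1, ht.2.trans (hR t).2⟩).trans (le_abs_self _)
  set S : Set (WeakDual ℝ (Lp ℝ 2 μ)) := ⋂ (A : Set T) (hA : MeasurableSet A),
    {φ | ∫ t in A, l t ∂μ ≤ φ (indicatorConstLp 2 hA (measure_ne_top μ A) (1 : ℝ)) ∧
      φ (indicatorConstLp 2 hA (measure_ne_top μ A) (1 : ℝ)) ≤ ∫ t in A, u t ∂μ} with hS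
  have hSc : IsClosed S := by
    refine isClosed_iInter fun A => isClosed_iInter fun hA => ?_
    exact (isClosed_le continuous_const (WeakDual.eval_continuous _)).inter
      (isClosed_le (WeakDual.eval_continuous _) continuous_const)
  have : l2OrderInterval μ l u =
      (WeakDual.toStrongDual ⁻¹' Metric.closedBall (0 : StrongDual ℝ (Lp ℝ 2 μ)) r) ∩ S := by
    ext φ
    constructor
    · rintro ⟨g, hg, hφ⟩
      constructor
      · rw [mem_preimage, mem_closedBall_zero_iff]
        refine ContinuousLinearMap.opNorm_le_bound _ ((norm_nonneg g).trans (hr g hg)) fun k => ?_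
        change ‖φ k‖ ≤ _
        rw [hφ]
        refine (norm_inner_le_norm k g).trans ?_
        rw [mul_comm]
        exact mul_le_mul_of_nonneg_right (hr g hg) (norm_nonneg _)
      · simp only [hS, mem_iInter]
        intro A hA
        have hgi := integrable_l2 g
        simp only [mem_ofPred_eq, hφ, L2.inner_indicatorConstLp_one]
        exact ⟨setIntegral_mono_ae hl.integrableOn hgi.integrableOn (hg.mono fun t h => h.1),
          setIntegral_mono_ae hgi.integrableOn hu.integrableOn (hg.mono fun t h => h.2)⟩
    · rintro ⟨hb, hφ⟩
      have key : ∀ k, φ k =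
          inner ℝ k ((InnerProductSpace.toDual ℝ (Lp ℝ 2 μ)).symm (WeakDual.toStrongDual φ)) := by
        intro k
        rw [real_inner_comm, InnerProductSpace.toDual_symm_apply]
        rfl
      refine ⟨_, ae_between_of_setIntegral (integrable_l2 _) hl hu fun A hA => ?_, key⟩
      simp only [hS, mem_iInter] at hφ
      have := hφ A hA
      simpa only [mem_ofPred_eq, key, L2.inner_indicatorConstLp_one] using this
  rw [this]
  exact (WeakDual.isCompact_closedBall _ _).inter_right hSc

/-- `g` is the limit of `h` along `F` when tested against measurable sets. -/
def WeakLim (μ : Measure T) (F : Filter ℕ) (h : ℕ → T → ℝ) (g : T → ℝ) : Prop :=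
  Integrable g μ ∧ (∀ n, Integrable (h n) μ) ∧
    ∀ A, MeasurableSet A → Tendsto (fun n => ∫ t in A, h n t ∂μ) F (𝓝 (∫ t in A, g t ∂μ))

/-- An ultrafilter converges in any compact set containing it. Fixing one ultrafilter makes all the
weak limits taken later exist simultaneously, with no passage to subsequences. -/
lemma exists_weakLim (F : Ultrafilter ℕ) {h : ℕ → T → ℝ} (hm : ∀ n, Measurable (h n))
    (hb : ∀ n t, 0 ≤ h n t ∧ h n t ≤ 1) :
    ∃ g, Measurable g ∧ WeakLim μ F h g := by
  have hL : ∀ n, MemLp (h n) 2 μ := fun n =>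
    MemLp.of_bound (hm n).aestronglyMeasurable 1 <| Eventually.of_forall fun t => by
      rw [Real.norm_eq_abs, abs_of_nonneg (hb n t).1]; exact (hb n t).2
  have hc : IsCompact (l2OrderInterval μ (fun _ => 0) fun _ => 1) :=
    isCompact_l2OrderInterval (integrable_const _) (integrable_const _) (R := 1)
      fun t => by norm_num
  let φ : ℕ → WeakDual ℝ (Lp ℝ 2 μ) := fun n =>
    StrongDual.toWeakDual (InnerProductSpace.toDual ℝ (Lp ℝ 2 μ) (hL n).toLp)
  have hφk : ∀ n k, φ n k = inner ℝ k (hL n).toLp := fun n k => by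
    rw [real_inner_comm]
    exact InnerProductSpace.toDual_apply_apply
  have hφ : ∀ n, φ n ∈ l2OrderInterval μ (fun _ => 0) fun _ => 1 := by
    intro n
    refine ⟨(hL n).toLp, ?_, hφk n⟩
    filter_upwards [(hL n).coeFn_toLp] with t ht
    rw [ht]; exact hb n t
  obtain ⟨ψ, ⟨g, hg, hgk⟩, hψ⟩ := hc.ultrafilter_le_nhds (F.map φ)
    (le_principal_iff.2 <| Ultrafilter.mem_map.2 <| Eventually.of_forall hφ)
  have hgi := integrable_l2 g
  refine ⟨hgi.aestronglyMeasurable.mk g, hgi.aestronglyMeasurable.stronglyMeasurable_mk.measurable,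
    hgi.congr hgi.aestronglyMeasurable.ae_eq_mk, fun n => (hL n).integrable one_le_two,
    fun A hA => ?_⟩
  rw [← setIntegral_congr_ae hA (hgi.aestronglyMeasurable.ae_eq_mk.mono fun t ht _ => ht)]
  have h1 := ((WeakDual.eval_continuous
    (indicatorConstLp 2 hA (measure_ne_top μ A) (1 : ℝ))).tendsto ψ).comp
      (show Tendsto φ F (𝓝 ψ) from hψ)
  simp only [Function.comp_def, hφk, hgk, L2.inner_indicatorConstLp_one] at h1
  refine h1.congr fun n => ?_
  exact setIntegral_congr_ae hA ((hL n).coeFn_toLp.mono fun t ht _ => ht)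

omit [IsFiniteMeasure μ] in
lemma WeakLim.sub {F : Filter ℕ} {h h' : ℕ → T → ℝ} {g g' : T → ℝ} (H : WeakLim μ F h g)
    (H' : WeakLim μ F h' g') :
    WeakLim μ F (fun n t => h n t - h' n t) (fun t => g t - g' t) := by
  refine ⟨H.1.sub H'.1, fun n => (H.2.1 n).sub (H'.2.1 n), fun A hA => ?_⟩
  rw [integral_sub H.1.integrableOn H'.1.integrableOn]
  exact ((H.2.2 A hA).sub (H'.2.2 A hA)).congr fun n =>
    (integral_sub (H.2.1 n).integrableOn (H'.2.1 n).integrableOn).symm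

omit [IsFiniteMeasure μ] in
lemma WeakLim.add {F : Filter ℕ} {h h' : ℕ → T → ℝ} {g g' : T → ℝ} (H : WeakLim μ F h g)
    (H' : WeakLim μ F h' g') :
    WeakLim μ F (fun n t => h n t + h' n t) (fun t => g t + g' t) := by
  refine ⟨H.1.add H'.1, fun n => (H.2.1 n).add (H'.2.1 n), fun A hA => ?_⟩
  rw [integral_add H.1.integrableOn H'.1.integrableOn]
  exact ((H.2.2 A hA).add (H'.2.2 A hA)).congr fun n =>
    (integral_add (H.2.1 n).integrableOn (H'.2.1 n).integrableOn).symm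

omit [IsFiniteMeasure μ] in
lemma WeakLim.const_mul {F : Filter ℕ} {h : ℕ → T → ℝ} {g : T → ℝ} (H : WeakLim μ F h g)
    (c : ℝ) : WeakLim μ F (fun n t => c * h n t) (fun t => c * g t) := by
  refine ⟨H.1.const_mul c, fun n => (H.2.1 n).const_mul c, fun A hA => ?_⟩
  rw [integral_const_mul]
  exact ((H.2.2 A hA).const_mul c).congr fun n => (integral_const_mul _ _).symm

omit [IsFiniteMeasure μ] in
lemma WeakLim.indicator {F : Filter ℕ} {h : ℕ → T → ℝ} {g : T → ℝ} (H : WeakLim μ F h g)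
    {B : Set T} (hB : MeasurableSet B) :
    WeakLim μ F (fun n => B.indicator (h n)) (B.indicator g) := by
  refine ⟨H.1.indicator hB, fun n => (H.2.1 n).indicator hB, fun A hA => ?_⟩
  simp only [setIntegral_indicator hB]
  exact H.2.2 _ (hA.inter hB)

omit [IsFiniteMeasure μ] in
lemma WeakLim.le {F : Filter ℕ} [F.NeBot] {h h' : ℕ → T → ℝ} {g g' : T → ℝ}
    (H : WeakLim μ F h g) (H' : WeakLim μ F h' g') (hle : ∀ n t, h n t ≤ h' n t) :
    ∀ᵐ t ∂μ, g t ≤ g' t := by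
  refine ae_le_of_forall_setIntegral_le H.1 H'.1 fun s hs _ => ?_
  exact le_of_tendsto_of_tendsto' (H.2.2 s hs) (H'.2.2 s hs) fun n =>
    setIntegral_mono (H.2.1 n).integrableOn (H'.2.1 n).integrableOn (hle n)

lemma weakLim_const (F : Filter ℕ) (c : ℝ) : WeakLim μ F (fun _ _ => c) fun _ => c :=
  ⟨integrable_const _, fun _ => integrable_const _, fun _ _ => tendsto_const_nhds⟩

end WeakCompactness

/-! ### Lyapunov's theorem by extreme points. -/

section Lyapunov

variable {T : Type*} [MeasurableSpace T] {μ : Measure T}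

/-- No measurable subset of `B` of positive measure is an atom. -/
def AtomlessOn (μ : Measure T) (B : Set T) : Prop :=
  ∀ C ⊆ B, MeasurableSet C → μ C ≠ 0 → ∃ D ⊆ C, MeasurableSet D ∧ μ D ≠ 0 ∧ μ (C \ D) ≠ 0

lemma AtomlessOn.mono {B B' : Set T} (h : AtomlessOn μ B) (hB : B' ⊆ B) : AtomlessOn μ B' :=
  fun C hC => h C (hC.trans hB)

lemma AtomlessOn.exists_disjoint {B : Set T} (h : AtomlessOn μ B) (hB : MeasurableSet B)
    (h0 : μ B ≠ 0) (n : ℕ) : ∃ C : Fin n → Set T, (∀ i, MeasurableSet (C i)) ∧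
      (∀ i, C i ⊆ B) ∧ (∀ i, μ (C i) ≠ 0) ∧ Pairwise fun i j => Disjoint (C i) (C j) := by
  induction n generalizing B with
  | zero => exact ⟨Fin.elim0, fun i => i.elim0, fun i => i.elim0, fun i => i.elim0,
      fun i => i.elim0⟩
  | succ n ih =>
    obtain ⟨D, hDB, hD, hD0, hD1⟩ := h B subset_rfl hB h0
    obtain ⟨C, hC1, hC2, hC3, hC4⟩ := ih (h.mono sdiff_subset) (hB.diff hD) hD1
    refine ⟨Fin.cons D C, ?_, ?_, ?_, ?_⟩
    · exact Fin.cases hD hC1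
    · exact Fin.cases hDB fun i => (hC2 i).trans sdiff_subset
    · exact Fin.cases hD0 hC3
    · have hd : ∀ i, Disjoint D (C i) := fun i => disjoint_sdiff_right.mono_right (hC2 i)
      intro i j hij
      induction i using Fin.cases with
      | zero =>
        induction j using Fin.cases with
        | zero => exact absurd rfl hij
        | succ j => exact hd j
      | succ i =>
        induction j using Fin.cases with
        | zero => exact (hd i).symm
        | succ j => exact hC4 fun h => hij (congrArg Fin.succ h)

variable [IsFiniteMeasure μ]

omit [IsFiniteMeasure μ] in
/-- On an atomless set there is a bounded non-trivial function orthogonal to finitely many given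
functions. -/
lemma AtomlessOn.exists_orthogonal {ι : Type*} [Fintype ι] {B : Set T} (hA : AtomlessOn μ B)
    (hB : MeasurableSet B) (h0 : μ B ≠ 0) {h : ι → T → ℝ} (hi : ∀ j, Integrable (h j) μ)
    {ε : ℝ} (hε : 0 < ε) :
    ∃ η : T → ℝ, Measurable η ∧ (∀ t, |η t| ≤ ε) ∧ (∀ t ∉ B, η t = 0) ∧
      (∀ j, ∫ t, h j t * η t ∂μ = 0) ∧ ¬ (∀ᵐ t ∂μ, η t = 0) := by
  classical
  obtain ⟨C, hC1, hC2, hC3, hC4⟩ := hA.exists_disjoint hB h0 (Fintype.card ι + 1)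
  -- There is one more piece than there are functions, so the moment vectors of the pieces are
  -- linearly dependent. The coefficients give a step function orthogonal to every `h j`; dividing
  -- by the sum of their absolute values keeps it below `ε`.
  obtain ⟨c, hc, i₀, hi₀⟩ := Fintype.not_linearIndependent_iff.1
    (show ¬ LinearIndependent ℝ (fun i j => ∫ t in C i, h j t ∂μ) from fun H => by
      have := H.fintype_card_le_finrank
      simp at this)
  set N := ∑ i, |c i| with hN
  have hN0 : 0 < N := Finset.sum_pos' (fun i _ => abs_nonneg _)
    ⟨i₀, Finset.mem_univ _, abs_pos.2 hi₀⟩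
  refine ⟨fun t => ε / N * ∑ i, (C i).indicator (fun _ => c i) t, ?_, ?_, ?_, ?_, ?_⟩
  · exact (Finset.measurable_sum _ fun i _ => measurable_const.indicator (hC1 i)).const_mul _
  · intro t
    rw [abs_mul, abs_of_pos (div_pos hε hN0), div_mul_eq_mul_div, div_le_iff₀ hN0]
    refine mul_le_mul_of_nonneg_left ((Finset.abs_sum_le_sum_abs _ _).trans ?_) hε.le
    refine Finset.sum_le_sum fun i _ => ?_
    by_cases ht : t ∈ C i <;> simp [ht]
  · intro t ht
    beta_reduce
    rw [Finset.sum_eq_zero fun i _ => indicator_of_notMem (fun h => ht (hC2 i h)) _, mul_zero]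
  · intro j
    have : ∀ t, h j t * (ε / N * ∑ i, (C i).indicator (fun _ => c i) t) =
        ε / N * ∑ i, c i * (C i).indicator (h j) t := fun t => by
      rw [Finset.mul_sum, Finset.mul_sum, Finset.mul_sum]
      refine Finset.sum_congr rfl fun i _ => ?_
      by_cases ht : t ∈ C i <;> (simp [ht]; try ring)
    simp only [this]
    rw [integral_const_mul, integral_finsetSum _ fun i _ => ((hi j).indicator (hC1 i)).const_mul _]
    simp only [integral_const_mul, integral_indicator (hC1 _)]
    have := congrFun hc j
    simp only [Finset.sum_apply, Pi.smul_apply, smul_eq_mul, Pi.zero_apply] at this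
    rw [this, mul_zero]
  · intro H
    refine hC3 i₀ (measure_mono_null (fun t ht => ?_) (ae_iff.1 H))
    have : ∑ i, (C i).indicator (fun _ => c i) t = c i₀ := by
      rw [Finset.sum_eq_single i₀ (fun i _ hi => indicator_of_notMem
        (fun h => (hC4 hi).le_bot ⟨h, ht⟩) _) (by simp), indicator_of_mem ht]
    simp only [mem_ofPred_eq, this]
    exact mul_ne_zero (div_pos hε hN0).ne' hi₀

/-- Lyapunov's theorem: a weight function may be replaced by a set without changing finitely many
moments, provided that the weight is fractional on an atomless set only. -/
theorem exists_set_integral_eq {ι : Type*} [Fintype ι] {β : T → ℝ} (hβ : Measurable β)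
    (h01 : ∀ t, 0 ≤ β t ∧ β t ≤ 1) (hA : AtomlessOn μ {t | 0 < β t ∧ β t < 1})
    {h : ι → T → ℝ} (hm : ∀ j, MemLp (h j) 2 μ) :
    ∃ A, MeasurableSet A ∧ (∀ᵐ t ∂μ, t ∈ A → 0 < β t) ∧ (∀ᵐ t ∂μ, t ∉ A → β t < 1) ∧
      ∀ j, ∫ t in A, h j t ∂μ = ∫ t, β t * h j t ∂μ := by
  classical
  have hi : ∀ j, Integrable (h j) μ := fun j => (hm j).integrable one_le_two
  -- The bounds `l` and `u` pin a competitor to `1` where `β = 1` and to `0` where `β = 0`; it is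
  -- free in `[0, 1]` only on the atomless set.
  set l : T → ℝ := {t | 1 ≤ β t}.indicator fun _ => 1 with hl
  set u : T → ℝ := {t | 0 < β t}.indicator fun _ => 1 with hu
  have hlm : MeasurableSet {t | 1 ≤ β t} := measurableSet_le measurable_const hβ
  have hum : MeasurableSet {t | 0 < β t} := measurableSet_lt measurable_const hβ
  have hl0 : ∀ t, 0 ≤ l t := fun t => indicator_nonneg (fun _ _ => zero_le_one) _
  have hu1 : ∀ t, u t ≤ 1 := fun t => indicator_le_self' (fun _ _ => zero_le_one) _
  have hcomp := isCompact_l2OrderInterval (μ := μ) ((integrable_const (1 : ℝ)).indicator hlm)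
    ((integrable_const (1 : ℝ)).indicator hum) (R := 1)
    fun t => ⟨by linarith [hl0 t], hu1 t⟩
  set M : Set (WeakDual ℝ (Lp ℝ 2 μ)) := l2OrderInterval μ l u ∩
    ⋂ j, {φ | φ (hm j).toLp = ∫ t, β t * h j t ∂μ} with hM
  have hMc : IsCompact M := hcomp.inter_right <| isClosed_iInter fun j =>
    isClosed_eq (WeakDual.eval_continuous _) continuous_const
  have hinner : ∀ (g : Lp ℝ 2 μ) j, inner ℝ (hm j).toLp g = ∫ t, g t * h j t ∂μ := fun g j => by
    rw [L2.inner_def]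
    refine integral_congr_ae ?_
    filter_upwards [(hm j).coeFn_toLp] with t ht
    simp [ht]
  have hβL : MemLp β 2 μ := MemLp.of_bound hβ.aestronglyMeasurable 1 <| Eventually.of_forall
    fun t => by rw [Real.norm_eq_abs, abs_of_nonneg (h01 t).1]; exact (h01 t).2
  let Φ : Lp ℝ 2 μ → WeakDual ℝ (Lp ℝ 2 μ) := fun g =>
    StrongDual.toWeakDual (InnerProductSpace.toDual ℝ (Lp ℝ 2 μ) g)
  have hΦ : ∀ g k, Φ g k = inner ℝ k g := fun g k => by
    rw [real_inner_comm]
    exact InnerProductSpace.toDual_apply_apply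
  have hMΦ : ∀ g : Lp ℝ 2 μ, (∀ᵐ t ∂μ, l t ≤ g t ∧ g t ≤ u t) →
      (∀ j, ∫ t, g t * h j t ∂μ = ∫ t, β t * h j t ∂μ) → Φ g ∈ M := by
    intro g h1 h2
    refine ⟨⟨g, h1, hΦ g⟩, mem_iInter.2 fun j => ?_⟩
    rw [mem_ofPred_eq, hΦ, hinner, h2]
  have hMne : M.Nonempty := by
    refine ⟨_, hMΦ hβL.toLp ?_ fun j => ?_⟩
    · filter_upwards [hβL.coeFn_toLp] with t ht
      rw [ht]
      constructor
      · by_cases h1 : 1 ≤ β t <;> simp [l, h1, (h01 t).1]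
      · by_cases h1 : 0 < β t
        · simp [u, h1, (h01 t).2]
        · simp [u, h1, not_lt.1 h1]
    · exact integral_congr_ae (hβL.coeFn_toLp.mono fun t ht => by simp only [ht])
  have : LocallyConvexSpace ℝ (WeakDual ℝ (Lp ℝ 2 μ)) :=
    inferInstanceAs (LocallyConvexSpace ℝ (WeakBilin _))
  -- An extreme point of the set of competitors with the prescribed moments takes only the values
  -- `0` and `1`, and so is the indicator of the required set.
  obtain ⟨φ, hφ⟩ := hMc.extremePoints_nonempty hMne
  obtain ⟨⟨⟨g, hg, hgφ⟩, hφj⟩, hext⟩ := mem_extremePoints.1 hφ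
  have hgj : ∀ j, ∫ t, g t * h j t ∂μ = ∫ t, β t * h j t ∂μ := fun j => by
    rw [← hinner, ← hgφ]; exact mem_iInter.1 hφj j
  have hgm : Measurable g := (Lp.stronglyMeasurable g).measurable
  have hgL : MemLp g 2 μ := Lp.memLp g
  have hlu : ∀ t, 0 < β t ∧ β t < 1 → l t = 0 ∧ u t = 1 := fun t ht => by
    simp [l, u, ht.1, ht.2]
  -- Otherwise a nonzero `η` bounded by `ε`, supported on this set and orthogonal to all `h j`,
  -- makes `g` the midpoint of the competitors `g + η` and `g - η`.
  have hgε : ∀ ε : ℝ, 0 < ε → μ {t | (0 < β t ∧ β t < 1) ∧ ε ≤ g t ∧ g t ≤ 1 - ε} = 0 := by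
    intro ε hε
    by_contra hne
    have hCm : MeasurableSet {t | (0 < β t ∧ β t < 1) ∧ ε ≤ g t ∧ g t ≤ 1 - ε} :=
      ((measurableSet_lt measurable_const hβ).inter (measurableSet_lt hβ measurable_const)).inter
        ((measurableSet_le measurable_const hgm).inter (measurableSet_le hgm measurable_const))
    obtain ⟨η, hη, hηε, hη0, hηh, hηne⟩ := (hA.mono fun t ht => ht.1).exists_orthogonal
      hCm hne hi hε
    have hηL : MemLp η 2 μ := MemLp.of_bound hη.aestronglyMeasurable ε <| Eventually.of_forall hηε
    have hgh : ∀ j, Integrable (fun t => g t * h j t) μ := fun j => hgL.integrable_mul (hm j)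
    have hηhi : ∀ j, Integrable (fun t => h j t * η t) μ := fun j => (hm j).integrable_mul hηL
    have hbd : ∀ᵐ t ∂μ, (l t ≤ g t + η t ∧ g t + η t ≤ u t) ∧
        l t ≤ g t - η t ∧ g t - η t ≤ u t := by
      filter_upwards [hg] with t ht
      by_cases htC : t ∈ {t | (0 < β t ∧ β t < 1) ∧ ε ≤ g t ∧ g t ≤ 1 - ε}
      · have h1 := abs_le.1 (hηε t)
        obtain ⟨h2, h3, h4⟩ := htC
        rw [(hlu t h2).1, (hlu t h2).2]
        refine ⟨⟨?_, ?_⟩, ?_, ?_⟩ <;> linarith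
      · rw [hη0 t htC]; simpa using ht
    have h1 : Φ (g + hηL.toLp) ∈ M := by
      refine hMΦ _ ?_ fun j => ?_
      · filter_upwards [hbd, hηL.coeFn_toLp, Lp.coeFn_add g hηL.toLp] with t ht h1 h2
        rw [h2, Pi.add_apply, h1]; exact ht.1
      · rw [← hgj, ← add_zero (∫ t, g t * h j t ∂μ), ← hηh j, ← integral_add (hgh j) (hηhi j)]
        refine integral_congr_ae ?_
        filter_upwards [hηL.coeFn_toLp, Lp.coeFn_add g hηL.toLp] with t h1 h2
        rw [h2, Pi.add_apply, h1]; ring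
    have h2 : Φ (g - hηL.toLp) ∈ M := by
      refine hMΦ _ ?_ fun j => ?_
      · filter_upwards [hbd, hηL.coeFn_toLp, Lp.coeFn_sub g hηL.toLp] with t ht h1 h2
        rw [h2, Pi.sub_apply, h1]; exact ht.2
      · rw [← hgj, ← sub_zero (∫ t, g t * h j t ∂μ), ← hηh j, ← integral_sub (hgh j) (hηhi j)]
        refine integral_congr_ae ?_
        filter_upwards [hηL.coeFn_toLp, Lp.coeFn_sub g hηL.toLp] with t h1 h2
        rw [h2, Pi.sub_apply, h1]; ring
    have hφΦ : φ = Φ g := DFunLike.ext _ _ fun k => by rw [hgφ, hΦ]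
    have h3 := (hext _ h1 _ h2 ⟨1 / 2, 1 / 2, by norm_num, by norm_num, by norm_num, by
      rw [← smul_add]
      refine DFunLike.ext _ _ fun k => ?_
      change (1 / 2 : ℝ) * (Φ (g + hηL.toLp) k + Φ (g - hηL.toLp) k) = φ k
      rw [hΦ, hΦ, hgφ, inner_add_right, inner_sub_right]; ring⟩).1
    rw [hφΦ] at h3
    have h4 : g + hηL.toLp = g := (InnerProductSpace.toDual ℝ (Lp ℝ 2 μ)).injective h3
    have h5 : hηL.toLp = 0 := by simpa using h4
    refine hηne ?_
    filter_upwards [hηL.coeFn_toLp, Lp.eq_zero_iff_ae_eq_zero.1 h5] with t h6 h7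
    rw [← h6, h7]; rfl
  have hg01 : ∀ᵐ t ∂μ, 0 < β t ∧ β t < 1 → g t ≤ 0 ∨ 1 ≤ g t := by
    have : ∀ᵐ t ∂μ, ∀ n : ℕ,
        ¬ ((0 < β t ∧ β t < 1) ∧ 1 / ((n : ℝ) + 1) ≤ g t ∧ g t ≤ 1 - 1 / ((n : ℝ) + 1)) :=
      ae_all_iff.2 fun n => ae_iff.2 <| by
        simpa only [not_not] using hgε _ Nat.one_div_pos_of_nat
    filter_upwards [this] with t ht h1
    by_contra! hc
    obtain ⟨n, hn⟩ := exists_nat_one_div_lt (lt_min hc.1 (sub_pos.2 hc.2))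
    refine ht n ⟨h1, (hn.trans_le (min_le_left _ _)).le, ?_⟩
    linarith [hn.trans_le (min_le_right _ _)]
  have hAm : MeasurableSet {t | 1 ≤ g t} := measurableSet_le measurable_const hgm
  refine ⟨{t | 1 ≤ g t}, hAm, ?_, ?_, fun j => ?_⟩
  · filter_upwards [hg] with t ht h1
    by_contra h2
    have : u t = 0 := by simp [u, h2]
    have h1 : 1 ≤ g t := h1
    linarith [ht.2]
  · filter_upwards [hg] with t ht h1
    by_contra! h2
    have : l t = 1 := by simp [l, h2]
    exact h1 (this ▸ ht.1)
  · rw [← hgj, ← integral_indicator hAm]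
    refine integral_congr_ae ?_
    filter_upwards [hg, hg01] with t ht h1
    have h0 := (hl0 t).trans ht.1
    have h2 := ht.2.trans (hu1 t)
    by_cases h3 : 1 ≤ g t
    · simp [le_antisymm h2 h3]
    · have h4 : g t = 0 := by
        rcases lt_trichotomy 0 (β t) with h5 | h5 | h5
        · rcases lt_or_ge (β t) 1 with h6 | h6
          · exact le_antisymm ((h1 ⟨h5, h6⟩).resolve_right h3) h0
          · have : l t = 1 := by simp [l, h6]
            exact absurd (this ▸ ht.1) h3
        · have : u t = 0 := by simp [u, ← h5]
          exact le_antisymm (this ▸ ht.2) h0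
        · exact absurd (h01 t).1 (not_le.2 h5)
      simp [h4]

end Lyapunov

/-! ### Splitting conditional means along a cut. -/

section Refinement

variable {T : Type*} [MeasurableSpace T] {μ : Measure T} [IsFiniteMeasure μ]
  {ι : Type*} [Fintype ι]

-- On a set that cannot be split, each indicator integrates to `0` or to the full measure, and this
-- two-point set is closed.
omit [IsFiniteMeasure μ] in
lemma weakLim_indicator_atom {F : Filter ℕ} [F.NeBot] {C : Set T} (hC : MeasurableSet C)
    (hat : ∀ D ⊆ C, MeasurableSet D → μ D = 0 ∨ μ (C \ D) = 0) {K : ℕ → Set T}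
    (hK : ∀ n, MeasurableSet (K n)) {γ : T → ℝ}
    (h : WeakLim μ F (fun n => (K n).indicator fun _ => 1) γ) :
    ∫ t in C, γ t ∂μ = 0 ∨ ∫ t in C, γ t ∂μ = μ.real C := by
  have hcl : IsClosed ({0, μ.real C} : Set ℝ) := (Set.toFinite _).isClosed
  refine hcl.mem_of_tendsto (h.2.2 C hC) (Eventually.of_forall fun n => ?_)
  rw [setIntegral_indicator (hK n), setIntegral_const, smul_eq_mul, mul_one]
  rcases hat (C ∩ K n) inter_subset_left (hC.inter (hK n)) with h0 | h0
  · left; rw [measureReal_def, h0, ENNReal.toReal_zero]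
  · right
    rw [mem_singleton_iff, measureReal_def, measureReal_def]
    congr 1
    refine le_antisymm (measure_mono inter_subset_left) ?_
    calc μ C = μ ((C ∩ K n) ∪ (C \ (C ∩ K n))) := by rw [union_sdiff_cancel inter_subset_left]
      _ ≤ μ (C ∩ K n) + μ (C \ (C ∩ K n)) := measure_union_le _ _
      _ = μ (C ∩ K n) := by rw [h0, add_zero]

omit [IsFiniteMeasure μ] in
lemma setIntegral_pos_of_ae_pos {C : Set T} (hC : MeasurableSet C) (h0 : μ C ≠ 0) {γ : T → ℝ}
    (hi : Integrable γ μ) (hpos : ∀ᵐ t ∂μ, t ∈ C → 0 < γ t) : 0 < ∫ t in C, γ t ∂μ := by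
  have hpos' : ∀ᵐ t ∂μ.restrict C, 0 < γ t := (ae_restrict_iff' hC).2 hpos
  refine lt_of_le_of_ne (integral_nonneg_of_ae (hpos'.mono fun t h => h.le)) fun H => h0 ?_
  have := (integral_eq_zero_iff_of_nonneg_ae (hpos'.mono fun t h => h.le) hi.integrableOn).1 H.symm
  rw [measure_eq_zero_iff_ae_notMem]
  filter_upwards [(ae_restrict_iff' hC).1 this, hpos] with t h1 h2 htC
  exact (h2 htC).ne' (h1 htC)

/-- Along `F`, the functions `φ n` restricted to the sets `H n` have conditional means with
integral `v`. -/
def HasConditionalMean (μ : Measure T) (F : Filter ℕ) (φ : ℕ → ι → T → ℝ) (v : ι → ℝ)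
    (H : ℕ → Set T) (α : T → ℝ) (m : ι → T → ℝ) : Prop :=
  (∀ n, MeasurableSet (H n)) ∧ Measurable α ∧ (∀ j, Measurable (m j)) ∧
    WeakLim μ F (fun n => (H n).indicator fun _ => 1) α ∧
    (∀ j, WeakLim μ F (fun n => (H n).indicator (φ n j)) (m j)) ∧
    (∀ᵐ t ∂μ, 0 < α t) ∧ ∀ j, ∫ t, m j t / α t ∂μ = v j

omit [MeasurableSpace T] in
lemma indicator_split (H E A : Set T) (f : T → ℝ) :
    (H ∩ {t | t ∈ A ↔ t ∈ E}).indicator f = fun t =>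
      A.indicator ((H ∩ E).indicator f) t + Aᶜ.indicator ((H \ E).indicator f) t := by
  classical
  ext t
  by_cases hA : t ∈ A <;> by_cases hE : t ∈ E <;> by_cases hH : t ∈ H <;>
    simp [hA, hE, hH]

/-- Splitting `H n` by `E n` writes the conditional mean `m / α` as a mixture `β m'/α' + (1 - β)
m''/α''`, with `β = α'/α`. Lyapunov's theorem replaces `β` by the indicator of a set `A` without
changing the integral: over `A` the part inside `E n` is kept, off `A` the part outside. -/
lemma HasConditionalMean.refine {F : Ultrafilter ℕ} {φ : ℕ → ι → T → ℝ} {v : ι → ℝ}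
    (hφm : ∀ n j, Measurable (φ n j)) (hφ : ∀ n j t, 0 ≤ φ n j t ∧ φ n j t ≤ 1)
    {H : ℕ → Set T} {α : T → ℝ} {m : ι → T → ℝ} (hs : HasConditionalMean μ F φ v H α m)
    {E : ℕ → Set T} (hE : ∀ n, MeasurableSet (E n)) :
    ∃ A, MeasurableSet A ∧ ∃ α₁ m₁,
      HasConditionalMean μ F φ v (fun n => H n ∩ {t | t ∈ A ↔ t ∈ E n}) α₁ m₁ := by
  classical
  obtain ⟨hH, hαm, hmm, hα, hm, hα0, hv⟩ := hs
  have hHE : ∀ n, MeasurableSet (H n ∩ E n) := fun n => (hH n).inter (hE n)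
  have hHE' : ∀ n, MeasurableSet (H n \ E n) := fun n => (hH n).diff (hE n)
  obtain ⟨α', hα'm, hα'⟩ := exists_weakLim (μ := μ) F
    (h := fun n => (H n ∩ E n).indicator fun _ => 1)
    (fun n => measurable_const.indicator (hHE n)) fun n t => by
      by_cases h : t ∈ H n ∩ E n <;> simp [h]
  have hm'ex : ∀ j, ∃ g, Measurable g ∧
      WeakLim μ F (fun n => (H n ∩ E n).indicator (φ n j)) g := fun j =>
    exists_weakLim (μ := μ) F (fun n => (hφm n j).indicator (hHE n)) fun n t => by
      by_cases h : t ∈ H n ∩ E n <;> simp [h, hφ n j t]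
  choose m' hm'm hm' using hm'ex
  have hsub : ∀ (f : T → ℝ) n, (fun t => (H n).indicator f t - (H n ∩ E n).indicator f t) =
      (H n \ E n).indicator f := fun f n => by
    ext t
    by_cases h1 : t ∈ H n <;> by_cases h2 : t ∈ E n <;> simp [h1, h2]
  set α'' : T → ℝ := fun t => α t - α' t with hα''d
  set m'' : ι → T → ℝ := fun j t => m j t - m' j t with hm''d
  have hα'' : WeakLim μ F (fun n => (H n \ E n).indicator fun _ => 1) α'' := by
    exact (funext fun n => hsub _ n : (fun n t => _) = _) ▸ hα.sub hα'
  have hm'' : ∀ j, WeakLim μ F (fun n => (H n \ E n).indicator (φ n j)) (m'' j) := fun j => by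
    exact (funext fun n => hsub _ n : (fun n t => _) = _) ▸ (hm j).sub (hm' j)
  have hind : ∀ (K : ℕ → Set T) n t, 0 ≤ (K n).indicator (fun _ => (1 : ℝ)) t ∧
      (K n).indicator (fun _ => (1 : ℝ)) t ≤ 1 := fun K n t => by
    by_cases h : t ∈ K n <;> simp [h]
  have hindφ : ∀ (K : ℕ → Set T) n j t, 0 ≤ (K n).indicator (φ n j) t ∧
      (K n).indicator (φ n j) t ≤ (K n).indicator (fun _ => (1 : ℝ)) t := fun K n j t => by
    by_cases h : t ∈ K n <;> simp [h, hφ n j t]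
  have hα1 : ∀ᵐ t ∂μ, α t ≤ 1 := hα.le (weakLim_const F 1) fun n t => (hind _ n t).2
  have hα'0 : ∀ᵐ t ∂μ, 0 ≤ α' t := (weakLim_const F 0).le hα'
    fun n t => (hind (fun n => H n ∩ E n) n t).1
  have hα''0 : ∀ᵐ t ∂μ, 0 ≤ α'' t := (weakLim_const F 0).le hα''
    fun n t => (hind (fun n => H n \ E n) n t).1
  have hm'0 : ∀ᵐ t ∂μ, ∀ j, 0 ≤ m' j t ∧ m' j t ≤ α' t := ae_all_iff.2 fun j =>
    ((weakLim_const F 0).le (hm' j) fun n t => (hindφ (fun n => H n ∩ E n) n j t).1).and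
      ((hm' j).le hα' fun n t => (hindφ (fun n => H n ∩ E n) n j t).2)
  have hm''0 : ∀ᵐ t ∂μ, ∀ j, 0 ≤ m'' j t ∧ m'' j t ≤ α'' t := ae_all_iff.2 fun j =>
    ((weakLim_const F 0).le (hm'' j) fun n t => (hindφ (fun n => H n \ E n) n j t).1).and
      ((hm'' j).le hα'' fun n t => (hindφ (fun n => H n \ E n) n j t).2)
  -- The clamping changes `α' / α` on a null set only; it provides the bounds at every point.
  set β : T → ℝ := fun t => max 0 (min 1 (α' t / α t)) with hβd
  have hβm : Measurable β := measurable_const.max (measurable_const.min (hα'm.div hαm))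
  have hβ01 : ∀ t, 0 ≤ β t ∧ β t ≤ 1 := fun t =>
    ⟨le_max_left _ _, max_le zero_le_one (min_le_left _ _)⟩
  have hβα : ∀ᵐ t ∂μ, β t * α t = α' t := by
    filter_upwards [hα0, hα'0, hα''0] with t h0 h1 h2
    have : α' t / α t ≤ 1 := (div_le_one h0).2 (by simp only [hα''d] at h2; linarith)
    rw [hβd]
    simp only
    rw [min_eq_right this, max_eq_right (div_nonneg h1 h0.le), div_mul_cancel₀ _ h0.ne']
  -- On an atom `C` inside this set both `α'` and `α''` have positive integral, so each integrates
  -- to the full measure of `C`. Their sum `α` is at most `1`, which is a contradiction.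
  have hatomless : AtomlessOn μ {t | 0 < β t ∧ β t < 1} := by
    intro C hC hCm hC0
    by_contra! hcon
    have hat : ∀ D ⊆ C, MeasurableSet D → μ D = 0 ∨ μ (C \ D) = 0 := fun D hD hDm =>
      or_iff_not_imp_left.2 (hcon D hD hDm)
    have h1 : 0 < ∫ t in C, α' t ∂μ := setIntegral_pos_of_ae_pos hCm hC0 hα'.1 <| by
      filter_upwards [hβα, hα0] with t h1 h2 htC
      rw [← h1]; exact mul_pos (hC htC).1 h2
    have h2 : 0 < ∫ t in C, α'' t ∂μ := setIntegral_pos_of_ae_pos hCm hC0 hα''.1 <| by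
      filter_upwards [hβα, hα0] with t h1 h2 htC
      have h3 := mul_lt_mul_of_pos_right (hC htC).2 h2
      simp only [hα''d]; linarith
    have h3 := (weakLim_indicator_atom hCm hat hHE hα').resolve_left h1.ne'
    have h4 := (weakLim_indicator_atom hCm hat hHE' hα'').resolve_left h2.ne'
    have h5 : ∫ t in C, α t ∂μ ≤ ∫ t in C, (1 : ℝ) ∂μ :=
      setIntegral_mono_ae hα.1.integrableOn (integrable_const _).integrableOn hα1
    rw [setIntegral_const, smul_eq_mul, mul_one] at h5
    have h6 : ∫ t in C, α'' t ∂μ = ∫ t in C, α t ∂μ - ∫ t in C, α' t ∂μ :=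
      integral_sub hα.1.integrableOn hα'.1.integrableOn
    linarith
  have hdiv : ∀ {x y : ℝ}, 0 ≤ x → x ≤ y → 0 ≤ x / y ∧ x / y ≤ 1 := fun h1 h2 =>
    ⟨div_nonneg h1 (h1.trans h2), div_le_one_of_le₀ h2 (h1.trans h2)⟩
  have hm'i : ∀ j, Integrable (fun t => m' j t / α' t) μ := fun j =>
    Integrable.of_bound ((hm'm j).div hα'm).aestronglyMeasurable 1 <| by
      filter_upwards [hm'0] with t h
      rw [Real.norm_eq_abs, abs_of_nonneg (hdiv (h j).1 (h j).2).1]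
      exact (hdiv (h j).1 (h j).2).2
  have hα''m : Measurable α'' := hαm.sub hα'm
  have hm''m : ∀ j, Measurable (m'' j) := fun j => (hmm j).sub (hm'm j)
  have hm''i : ∀ j, Integrable (fun t => m'' j t / α'' t) μ := fun j =>
    Integrable.of_bound ((hm''m j).div hα''m).aestronglyMeasurable 1 <| by
      filter_upwards [hm''0] with t h
      rw [Real.norm_eq_abs, abs_of_nonneg (hdiv (h j).1 (h j).2).1]
      exact (hdiv (h j).1 (h j).2).2
  -- Only the difference of the two conditional means needs its moments preserved, since the mixture
  -- is `m''/α''` plus the weight times this difference.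
  obtain ⟨A, hA, hA0, hA1, hAint⟩ := exists_set_integral_eq hβm hβ01 hatomless
    (h := fun j t => m' j t / α' t - m'' j t / α'' t) fun j =>
      MemLp.of_bound (((hm'm j).div hα'm).sub ((hm''m j).div hα''m)).aestronglyMeasurable 1 <| by
        filter_upwards [hm'0, hm''0] with t h1 h2
        have h3 := hdiv (h1 j).1 (h1 j).2
        have h4 := hdiv (h2 j).1 (h2 j).2
        rw [Real.norm_eq_abs, abs_le]
        constructor <;> linarith
  have hdi : ∀ j, Integrable (fun t => m' j t / α' t - m'' j t / α'' t) μ := fun j =>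
    (hm'i j).sub (hm''i j)
  refine ⟨A, hA, fun t => A.indicator α' t + Aᶜ.indicator α'' t,
    fun j t => A.indicator (m' j) t + Aᶜ.indicator (m'' j) t, fun n => ?_, ?_, fun j => ?_, ?_,
    fun j => ?_, ?_, fun j => ?_⟩
  · refine (hH n).inter ?_
    exact MeasurableSet.iff (hA) (hE n)
  · exact (hα'm.indicator hA).add (hα''m.indicator hA.compl)
  · exact ((hm'm j).indicator hA).add ((hm''m j).indicator hA.compl)
  · simp only [indicator_split]
    exact (hα'.indicator hA).add (hα''.indicator hA.compl)
  · simp only [indicator_split]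
    exact ((hm' j).indicator hA).add ((hm'' j).indicator hA.compl)
  · filter_upwards [hA0, hA1, hβα, hα0] with t h1 h2 h3 h4
    by_cases h : t ∈ A
    · simp only [indicator_of_mem h, indicator_of_notMem (notMem_compl_iff.2 h), add_zero, ← h3]
      exact mul_pos (h1 h) h4
    · simp only [indicator_of_notMem h, indicator_of_mem (mem_compl h), zero_add, hα''d, ← h3]
      have := mul_lt_mul_of_pos_right (h2 h) h4
      linarith
  · have h1 : ∀ t, (A.indicator (m' j) t + Aᶜ.indicator (m'' j) t) /
        (A.indicator α' t + Aᶜ.indicator α'' t) =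
        A.indicator (fun t => m' j t / α' t - m'' j t / α'' t) t + m'' j t / α'' t := fun t => by
      by_cases h : t ∈ A <;> simp [h]
    simp only [h1]
    rw [integral_add ((hdi j).indicator hA) (hm''i j), integral_indicator hA,
      hAint j, ← integral_add ?_ (hm''i j), ← hv j]
    · refine integral_congr_ae ?_
      filter_upwards [hβα, hα0, hm'0, hm''0] with t h2 h3 h4 h5
      have h6 : m j t = m' j t + m'' j t := by simp [hm''d]
      have h7 : α'' t = (1 - β t) * α t := by simp only [hα''d, ← h2]; ring
      -- Where `β` vanishes, so does `α'`, hence also `m'`, which lies between `0` and `α'`;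
      -- division by zero is then harmless.
      have h8 : β t * (m' j t / α' t) = m' j t / α t := by
        rcases eq_or_ne (β t) 0 with h9 | h9
        · have : α' t = 0 := by rw [← h2, h9, zero_mul]
          have : m' j t = 0 := le_antisymm (this ▸ (h4 j).2) (h4 j).1
          simp [this]
        · rw [← h2]; field_simp
      have h9 : (1 - β t) * (m'' j t / α'' t) = m'' j t / α t := by
        rcases eq_or_ne (1 - β t) 0 with h9 | h9
        · have : α'' t = 0 := by rw [h7, h9, zero_mul]
          have : m'' j t = 0 := le_antisymm (this ▸ (h5 j).2) (h5 j).1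
          simp [this]
        · rw [h7]; field_simp
      rw [h6, add_div, ← h8, ← h9]; ring
    · refine (hdi j).bdd_mul (c := 1) hβm.aestronglyMeasurable <| Eventually.of_forall fun t => ?_
      rw [Real.norm_eq_abs, abs_of_nonneg (hβ01 t).1]; exact (hβ01 t).2

end Refinement

/-! ### Fatou's lemma for functions into the unit cube. -/

section Fatou

variable {T : Type*} [MeasurableSpace T] {μ : Measure T}

/-- If the points of a set of positive measure with `α > 0` all left `H n` from some fixed `N` on,
the indicators would integrate eventually to zero over that set, while `α` has positive integral
there. -/
lemma ae_frequently_mem_of_weakLim {F : Filter ℕ} [F.NeBot] (hF : F ≤ atTop)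
    {H : ℕ → Set T} (hH : ∀ n, MeasurableSet (H n)) {α : T → ℝ} (hαm : Measurable α)
    (h : WeakLim μ F (fun n => (H n).indicator fun _ => 1) α) :
    ∀ᵐ t ∂μ, 0 < α t → ∃ᶠ n in atTop, t ∈ H n := by
  have key : ∀ᵐ t ∂μ, ∀ N : ℕ, t ∉ {t | 0 < α t} ∩ ⋂ n ≥ N, (H n)ᶜ := by
    refine ae_all_iff.2 fun N => measure_eq_zero_iff_ae_notMem.1 ?_
    by_contra h0
    have hCm : MeasurableSet ({t | 0 < α t} ∩ ⋂ n ≥ N, (H n)ᶜ) :=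
      (measurableSet_lt measurable_const hαm).inter
        (MeasurableSet.iInter fun n => MeasurableSet.iInter fun _ => (hH n).compl)
    have h1 := setIntegral_pos_of_ae_pos hCm h0 h.1 (Eventually.of_forall fun t ht => ht.1)
    refine h1.ne' (tendsto_nhds_unique (h.2.2 _ hCm) ?_)
    refine tendsto_const_nhds.congr' ?_
    filter_upwards [hF (eventually_ge_atTop N)] with n hn
    rw [setIntegral_indicator (hH n), show ({t | 0 < α t} ∩ ⋂ n ≥ N, (H n)ᶜ) ∩ H n = ∅ from ?_]
    · simp
    · refine eq_empty_of_forall_notMem fun t ht => ?_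
      exact mem_iInter₂.1 ht.1.2 n hn ht.2
  filter_upwards [key] with t ht h0
  refine frequently_atTop.2 fun N => ?_
  by_contra! hcon
  exact ht N ⟨h0, mem_iInter₂.2 fun n hn => hcon n hn⟩

variable [IsFiniteMeasure μ] {ι : Type*} [Fintype ι]

omit [Fintype ι] in
lemma exists_hasConditionalMean_univ (F : Ultrafilter ℕ) {φ : ℕ → ι → T → ℝ}
    (hφm : ∀ n j, Measurable (φ n j)) (hφ : ∀ n j t, 0 ≤ φ n j t ∧ φ n j t ≤ 1) {v : ι → ℝ}
    (hv : ∀ j, Tendsto (fun n => ∫ t, φ n j t ∂μ) F (𝓝 (v j))) :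
    ∃ m, HasConditionalMean μ F φ v (fun _ => univ) (fun _ => 1) m := by
  choose m hm hw using fun j => exists_weakLim (μ := μ) F (fun n => hφm n j) fun n t => hφ n j t
  refine ⟨m, fun _ => MeasurableSet.univ, measurable_const, hm, ?_, ?_, by simp, fun j => ?_⟩
  · simpa using weakLim_const (μ := μ) F 1
  · simpa using hw
  · have := (hw j).2.2 univ MeasurableSet.univ
    simp only [Measure.restrict_univ] at this
    simpa using tendsto_nhds_unique this (hv j)

-- A bounded sequence eventually on one side of every rational upcrosses no rational interval
-- infinitely often.
omit [IsFiniteMeasure μ] [Fintype ι] in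
lemma exists_tendsto_of_separating {g : ℕ → ℝ} (hg : ∀ k, 0 ≤ g k ∧ g k ≤ 1)
    (h : ∀ q : ℚ, (∀ᶠ k in atTop, g k ≤ q) ∨ ∀ᶠ k in atTop, (q : ℝ) ≤ g k) :
    ∃ y, Tendsto g atTop (𝓝 y) := by
  refine tendsto_of_no_upcrossings (Rat.denseRange_cast (𝕜 := ℝ)) ?_
    (isBoundedUnder_of ⟨1, fun k => (hg k).2⟩) (isBoundedUnder_of ⟨0, fun k => (hg k).1⟩)
  rintro _ ⟨a, rfl⟩ _ ⟨b, rfl⟩ hab ⟨h1, h2⟩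
  rcases h a with h3 | h3
  · obtain ⟨k, h4, h5⟩ := (h2.and_eventually h3).exists
    linarith
  · obtain ⟨k, h4, h5⟩ := (h1.and_eventually h3).exists
    linarith

/-- Every limit of integrals of functions into a cube is the integral of a function whose values
are pointwise cluster points. -/
theorem exists_cluster_integral_of_unitCube [Nonempty ι] {F : Ultrafilter ℕ}
    (hF : (F : Filter ℕ) ≤ atTop) {φ : ℕ → ι → T → ℝ}
    (hφm : ∀ n j, Measurable (φ n j)) (hφ : ∀ n j t, 0 ≤ φ n j t ∧ φ n j t ≤ 1) {v : ι → ℝ}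
    (hv : ∀ j, Tendsto (fun n => ∫ t, φ n j t ∂μ) F (𝓝 (v j))) :
    ∃ f : ι → T → ℝ, (∀ j, Measurable (f j)) ∧ (∀ j, ∫ t, f j t ∂μ = v j) ∧
      ∀ᵐ t ∂μ, ∀ ε > 0, ∃ᶠ n in atTop, ∀ j, |φ n j t - f j t| < ε := by
  -- The cuts are indexed by a coordinate and a rational level. After cut `k`, the surviving values
  -- of `φ n` at `t` lie on a side of the level determined by `t` alone, through `A k`.
  obtain ⟨e, he⟩ := exists_surjective_nat (ι × ℚ)
  let E : ℕ → ℕ → Set T := fun k n => {t | φ n (e k).1 t < (e k).2}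
  have hE : ∀ k n, MeasurableSet (E k n) := fun k n =>
    measurableSet_lt (hφm _ _) measurable_const
  let State := {x : (ℕ → Set T) × (T → ℝ) × (ι → T → ℝ) //
    HasConditionalMean μ F φ v x.1 x.2.1 x.2.2}
  have hstep : ∀ (k : ℕ) (s : State), ∃ (s' : State) (A : Set T), MeasurableSet A ∧
      s'.1.1 = fun n => s.1.1 n ∩ {t | t ∈ A ↔ t ∈ E k n} := fun k s => by
    obtain ⟨A, hA, α, m, h⟩ := s.2.refine hφm hφ (hE k)
    exact ⟨⟨(_, α, m), h⟩, A, hA, rfl⟩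
  choose next B hB hnext using hstep
  obtain ⟨m₀, hm₀⟩ := exists_hasConditionalMean_univ F hφm hφ hv
  let S : ℕ → State := fun k => Nat.rec ⟨(_, _, m₀), hm₀⟩ (fun k s => next k s) k
  have hS : ∀ k, S (k + 1) = next k (S k) := fun k => rfl
  let H : ℕ → ℕ → Set T := fun k => (S k).1.1
  let α : ℕ → T → ℝ := fun k => (S k).1.2.1
  let m : ℕ → ι → T → ℝ := fun k => (S k).1.2.2
  let A : ℕ → Set T := fun k => B k (S k)
  have hP : ∀ k, HasConditionalMean μ F φ v (H k) (α k) (m k) := fun k => (S k).2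
  have hA : ∀ k, MeasurableSet (A k) := fun k => hB _ _
  have hsub : ∀ i k, i < k → ∀ n, H k n ⊆ {t | t ∈ A i ↔ t ∈ E i n} := by
    intro i k hik n
    induction k with
    | zero => omega
    | succ k ih =>
      have h1 : H (k + 1) n = H k n ∩ {t | t ∈ A k ↔ t ∈ E k n} := congrFun (hnext k (S k)) n
      rw [h1]
      rcases Nat.lt_succ_iff_lt_or_eq.1 hik with h2 | rfl
      · exact inter_subset_left.trans (ih h2)
      · exact inter_subset_right
  have hpos : ∀ᵐ t ∂μ, ∀ k, 0 < α k t := ae_all_iff.2 fun k => (hP k).2.2.2.2.2.1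
  have hfreq : ∀ᵐ t ∂μ, ∀ k, 0 < α k t → ∃ᶠ n in atTop, t ∈ H k n := ae_all_iff.2 fun k =>
    ae_frequently_mem_of_weakLim hF (hP k).1 (hP k).2.1 (hP k).2.2.2.1
  have hm01 : ∀ᵐ t ∂μ, ∀ k j, 0 ≤ m k j t ∧ m k j t ≤ α k t := by
    refine ae_all_iff.2 fun k => ae_all_iff.2 fun j => ?_
    refine ((weakLim_const F 0).le ((hP k).2.2.2.2.1 j) fun n t => ?_).and
      (((hP k).2.2.2.2.1 j).le (hP k).2.2.2.1 fun n t => ?_)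
    · exact indicator_nonneg (fun t _ => (hφ n j t).1) t
    · exact indicator_le_indicator (hφ n j t).2
  -- Inside `H k n` each earlier cut has been decided, and the resulting inequality between `φ n`
  -- and the level passes to weak limits over `A i` and over its complement.
  have hcut : ∀ᵐ t ∂μ, ∀ i k, i < k →
      (t ∈ A i → m k (e i).1 t ≤ (e i).2 * α k t) ∧
        (t ∉ A i → (e i).2 * α k t ≤ m k (e i).1 t) := by
    refine ae_all_iff.2 fun i => ae_all_iff.2 fun k => ?_
    by_cases hik : i < k
    swap
    · exact Eventually.of_forall fun t h => absurd h hik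
    have h1 := (hP k).2.2.2.2.1 (e i).1
    have h2 := (hP k).2.2.2.1.const_mul ((e i).2 : ℝ)
    have h3 := (h1.indicator (hA i)).le (h2.indicator (hA i)) fun n t => by
      by_cases hA' : t ∈ A i
      · by_cases hH' : t ∈ H k n
        · have := (hsub i k hik n hH').1 hA'
          simpa [hA', hH'] using this.le
        · simp [hA', hH']
      · simp [hA']
    have h4 := (h2.indicator (hA i).compl).le (h1.indicator (hA i).compl) fun n t => by
      by_cases hA' : t ∈ A i
      · simp [hA']
      · by_cases hH' : t ∈ H k n
        · have : ¬ φ n (e i).1 t < (e i).2 := fun h => hA' ((hsub i k hik n hH').2 h)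
          simpa [hA', hH'] using this
        · simp [hA', hH']
    filter_upwards [h3, h4] with t h5 h6 _
    refine ⟨fun h => ?_, fun h => ?_⟩
    · simpa [h] using h5
    · simpa [h] using h6
  have hg01 : ∀ᵐ t ∂μ, ∀ k j, 0 ≤ m k j t / α k t ∧ m k j t / α k t ≤ 1 := by
    filter_upwards [hm01, hpos] with t h1 h2 k j
    exact ⟨div_nonneg (h1 k j).1 (h2 k).le, div_le_one_of_le₀ (h1 k j).2 (h2 k).le⟩
  have hgcut : ∀ᵐ t ∂μ, ∀ i k, i < k →
      (t ∈ A i → m k (e i).1 t / α k t ≤ (e i).2) ∧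
        (t ∉ A i → (e i).2 ≤ m k (e i).1 t / α k t) := by
    filter_upwards [hcut, hpos] with t h1 h2 i k hik
    exact ⟨fun h => (div_le_iff₀ (h2 k)).2 ((h1 i k hik).1 h),
      fun h => (le_div_iff₀ (h2 k)).2 ((h1 i k hik).2 h)⟩
  have hgm : ∀ k j, Measurable fun t => m k j t / α k t := fun k j =>
    ((hP k).2.2.1 j).div (hP k).2.1
  have hlim : ∀ j, ∃ f : T → ℝ, Measurable f ∧
      ∀ᵐ t ∂μ, Tendsto (fun k => m k j t / α k t) atTop (𝓝 (f t)) := by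
    intro j
    refine measurable_limit_of_tendsto_metrizable_ae (fun k => (hgm k j).aemeasurable) ?_
    filter_upwards [hg01, hgcut] with t h1 h2
    refine exists_tendsto_of_separating (fun k => h1 k j) fun q => ?_
    obtain ⟨i, hi⟩ := he (j, q)
    have h3 := h2 i
    rw [hi] at h3
    by_cases hA' : t ∈ A i
    · exact Or.inl <| (eventually_gt_atTop i).mono fun k hk => (h3 k hk).1 hA'
    · exact Or.inr <| (eventually_gt_atTop i).mono fun k hk => (h3 k hk).2 hA'
  choose f hfm hf using hlim
  refine ⟨f, hfm, fun j => ?_, ?_⟩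
  · have h1 := tendsto_integral_of_dominated_convergence (μ := μ) (fun _ => (1 : ℝ))
      (fun k => (hgm k j).aestronglyMeasurable) (integrable_const _)
      (fun k => by
        filter_upwards [hg01] with t h
        rw [Real.norm_eq_abs, abs_of_nonneg (h k j).1]; exact (h k j).2) (hf j)
    refine tendsto_nhds_unique h1 ?_
    simp only [(hP _).2.2.2.2.2.2 j]
    exact tendsto_const_nhds
  · filter_upwards [hgcut, hpos, hfreq, ae_all_iff.2 hf] with t h1 h2 h3 h4 ε hε
    -- Choose rationals `q < f j t < r` within `ε` of the limit. The limit forces `t` above the cut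
    -- at `q` and below the cut at `r`, so every later `H k n` containing `t` traps `φ n j t`
    -- between them.
    have h5 : ∀ j, ∃ K, ∀ k ≥ K, ∀ n, t ∈ H k n → |φ n j t - f j t| < ε := by
      intro j
      obtain ⟨q, hq1, hq2⟩ := exists_rat_btwn (show f j t - ε < f j t by linarith)
      obtain ⟨r, hr1, hr2⟩ := exists_rat_btwn (show f j t < f j t + ε by linarith)
      obtain ⟨i, hi⟩ := he (j, q)
      obtain ⟨i', hi'⟩ := he (j, r)
      have hA1 : t ∉ A i := fun h => by
        refine hq2.not_ge (le_of_tendsto (h4 j) ?_)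
        filter_upwards [eventually_gt_atTop i] with k hk
        simpa only [hi] using (h1 i k hk).1 h
      have hA2 : t ∈ A i' := by
        by_contra h
        refine hr1.not_ge (ge_of_tendsto (h4 j) ?_)
        filter_upwards [eventually_gt_atTop i'] with k hk
        simpa only [hi'] using (h1 i' k hk).2 h
      refine ⟨max i i' + 1, fun k hk n hn => ?_⟩
      have h6 : ¬ φ n (e i).1 t < (e i).2 := fun h =>
        hA1 ((hsub i k (by omega) n hn).2 h)
      have h7 : φ n (e i').1 t < (e i').2 := (hsub i' k (by omega) n hn).1 hA2
      rw [hi] at h6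
      rw [hi'] at h7
      simp only [not_lt] at h6 h7
      rw [abs_lt]
      constructor <;> linarith
    choose K hK using h5
    refine (h3 (Finset.univ.sup K) (h2 _)).mono fun n hn j => ?_
    exact hK j _ (Finset.le_sup (Finset.mem_univ j)) n hn

end Fatou

/-! ### Reduction of dominated functions to the unit cube. -/

section DominatedFatou

variable {T : Type*} [MeasurableSpace T] {μ : Measure T}

/-- Every limit of integrals of dominated functions into the orthant is the integral of a function
whose values are pointwise cluster points. -/
theorem exists_cluster_integral [IsFiniteMeasure μ] {ℓ : ℕ} [Nonempty (Fin ℓ)] {W : T → ℝ}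
    (hWm : Measurable W) (hW : Integrable W μ) {f : ℕ → T → EuclideanSpace ℝ (Fin ℓ)}
    (hf : ∀ n, AEStronglyMeasurable (f n) μ)
    (hfW : ∀ n, ∀ᵐ t ∂μ, ∀ j, 0 ≤ f n t j ∧ f n t j ≤ W t) {v : EuclideanSpace ℝ (Fin ℓ)}
    (hv : Tendsto (fun n => ∫ t, f n t ∂μ) atTop (𝓝 v)) :
    ∃ g : T → EuclideanSpace ℝ (Fin ℓ), Integrable g μ ∧ ∫ t, g t ∂μ = v ∧
      ∀ᵐ t ∂μ, MapClusterPt (g t) atTop fun n => f n t := by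
  -- Dividing by `w` moves the functions into the cube, and passing to the measure with density `w`
  -- restores the integrals. The summand `1` keeps `w` positive, so that null sets of the new
  -- measure are null for `μ`.
  set w : T → NNReal := fun t => (W t).toNNReal + 1 with hw
  have hwm : Measurable w := hWm.real_toNNReal.add_const 1
  have hw1 : ∀ t, (0 : ℝ) < w t := fun t => by
    simp only [hw]; positivity
  have hwW : ∀ t, W t ≤ w t := fun t => by
    simp only [hw, NNReal.coe_add, NNReal.coe_one]
    linarith [Real.le_coe_toNNReal (W t)]
  have hwi : Integrable (fun t => (w t : ℝ)) μ := by
    simp only [hw, NNReal.coe_add, NNReal.coe_one, Real.coe_toNNReal']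
    exact hW.pos_part.add (integrable_const 1)
  set μ' := μ.withDensity fun t => (w t : ENNReal)
  have hfin : IsFiniteMeasure μ' := isFiniteMeasure_withDensity <| by
    have := hwi.lintegral_lt_top
    simpa only [ENNReal.ofReal_coe_nnreal] using this.ne
  have hac : μ ≪ μ' := withDensity_absolutelyContinuous' hwm.coe_nnreal_ennreal.aemeasurable
    (Eventually.of_forall fun t => by
      have := hw1 t
      simpa using (NNReal.coe_pos.1 this).ne')
  let φ : ℕ → Fin ℓ → T → ℝ := fun n j t => max 0 (min 1 ((hf n).mk (f n) t j / w t))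
  have hφm : ∀ n j, Measurable (φ n j) := fun n j => by
    have h1 : Measurable fun t => (hf n).mk (f n) t j :=
      (EuclideanSpace.proj j).continuous.measurable.comp (hf n).stronglyMeasurable_mk.measurable
    exact measurable_const.max (measurable_const.min (h1.div hwm.coe_nnreal_real))
  have hφ01 : ∀ n j t, 0 ≤ φ n j t ∧ φ n j t ≤ 1 := fun n j t =>
    ⟨le_max_left _ _, max_le zero_le_one (min_le_left _ _)⟩
  have hφf : ∀ n, ∀ᵐ t ∂μ, ∀ j, w t * φ n j t = f n t j := fun n => by
    filter_upwards [(hf n).ae_eq_mk, hfW n] with t h1 h2 j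
    have h3 : f n t j / w t ≤ 1 := (div_le_one (hw1 t)).2 ((h2 j).2.trans (hwW t))
    have h4 : 0 ≤ f n t j / w t := div_nonneg (h2 j).1 (hw1 t).le
    simp only [φ]
    rw [← h1, min_eq_right h3, max_eq_right h4, mul_div_cancel₀ _ (hw1 t).ne']
  have hfi : ∀ n j, Integrable (fun t => f n t j) μ := fun n j => by
    refine hwi.mono' ((EuclideanSpace.proj j).continuous.comp_aestronglyMeasurable (hf n)) ?_
    filter_upwards [hfW n] with t h
    change ‖f n t j‖ ≤ _
    rw [Real.norm_eq_abs, abs_of_nonneg (h j).1]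
    exact (h j).2.trans (hwW t)
  have hφv : ∀ j, Tendsto (fun n => ∫ t, φ n j t ∂μ') (hyperfilter ℕ) (𝓝 (v j)) := fun j => by
    have h1 := ((EuclideanSpace.proj (𝕜 := ℝ) j :
      EuclideanSpace ℝ (Fin ℓ) →L[ℝ] ℝ).continuous.tendsto v).comp
        (hv.mono_left (Nat.hyperfilter_le_atTop))
    refine h1.congr fun n => ?_
    change (∫ t, f n t ∂μ) j = _
    rw [eval_integral_piLp (hfi n), integral_withDensity_eq_integral_smul hwm]
    refine integral_congr_ae ?_
    filter_upwards [hφf n] with t ht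
    exact (ht j).symm
  obtain ⟨ψ, hψm, hψv, hψ⟩ := exists_cluster_integral_of_unitCube Nat.hyperfilter_le_atTop
    hφm hφ01 hφv
  have hψ2 : ∀ᵐ t ∂μ, ∀ j, |ψ j t| ≤ 2 := by
    filter_upwards [hac.ae_le hψ] with t ht j
    obtain ⟨n, hn⟩ := (ht 1 one_pos).exists
    have h1 := abs_lt.1 (hn j)
    have h2 := hφ01 n j t
    rw [abs_le]
    constructor <;> linarith
  have hgi : ∀ j, Integrable (fun t => w t * ψ j t) μ := fun j => by
    refine (hwi.const_mul 2).mono'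
      (hwm.coe_nnreal_real.mul (hψm j)).aestronglyMeasurable ?_
    filter_upwards [hψ2] with t ht
    rw [norm_mul, Real.norm_eq_abs, Real.norm_eq_abs, abs_of_pos (hw1 t), mul_comm]
    exact mul_le_mul_of_nonneg_right (ht j) (hw1 t).le
  refine ⟨fun t => WithLp.toLp 2 fun j => w t * ψ j t, integrable_piLp_iff.2 hgi, ?_, ?_⟩
  · ext j
    rw [eval_integral_piLp hgi, ← hψv j, integral_withDensity_eq_integral_smul hwm]
    rfl
  · filter_upwards [hac.ae_le hψ, ae_all_iff.2 hφf] with t h1 h2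
    rw [mapClusterPt_iff_frequently]
    intro s hs
    have hc : Continuous fun y : Fin ℓ → ℝ =>
        (WithLp.toLp 2 fun j => (w t : ℝ) * y j : EuclideanSpace ℝ (Fin ℓ)) := by fun_prop
    obtain ⟨ε, hε, hball⟩ := Metric.mem_nhds_iff.1 (hc.continuousAt (x := fun j => ψ j t) hs)
    refine (h1 ε hε).mono fun n hn => ?_
    have h3 : f n t = WithLp.toLp 2 fun j => (w t : ℝ) * φ n j t := by
      ext j; exact (h2 n j).symm
    rw [h3]
    refine hball (a := fun j => φ n j t) ?_
    rw [Metric.mem_ball, dist_pi_lt_iff hε]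
    exact hn

end DominatedFatou

/-! ### The space of agents and the stability of preferred sets. -/

section Agents

variable {ℓ : ℕ}

lemma orthant.isClosed (ℓ : ℕ) : IsClosed (orthant ℓ : Set (EuclideanSpace ℝ (Fin ℓ))) := by
  have h : (orthant ℓ : Set (EuclideanSpace ℝ (Fin ℓ))) = ⋂ h, {x | 0 ≤ x h} := by
    ext x
    rw [mem_iInter]
    exact Iff.rfl
  rw [h]
  exact isClosed_iInter fun h => isClosed_le continuous_const (by fun_prop)

instance orthant.instLocallyCompactSpace (ℓ : ℕ) : LocallyCompactSpace (orthant ℓ) :=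
  (orthant.isClosed ℓ).isClosedEmbedding_subtypeVal.locallyCompactSpace

instance utilityMeasurableSpace (ℓ : ℕ) : MeasurableSpace C(orthant ℓ, ℝ) :=
  borel _

instance utilityBorelSpace (ℓ : ℕ) : BorelSpace C(orthant ℓ, ℝ) :=
  ⟨rfl⟩

/-- Continuous strictly monotone utility functions. -/
abbrev Utility (ℓ : ℕ) : Type :=
  {u : C(orthant ℓ, ℝ) // ∀ x y : orthant ℓ, y ≠ 0 → u x < u (x + y)}

instance Utility.instSecondCountableTopology : SecondCountableTopology (Utility ℓ) :=
  (IsInducing.subtypeVal (t := fun u : C(orthant ℓ, ℝ) =>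
    ∀ x y : orthant ℓ, y ≠ 0 → u x < u (x + y))).secondCountableTopology

instance Utility.instPseudoMetrizableSpace :
    TopologicalSpace.PseudoMetrizableSpace (Utility ℓ) :=
  (IsInducing.subtypeVal (t := fun u : C(orthant ℓ, ℝ) =>
    ∀ x y : orthant ℓ, y ≠ 0 → u x < u (x + y))).pseudoMetrizableSpace

/-- An agent: an endowment and a utility function. -/
abbrev Agent (ℓ : ℕ) : Type :=
  orthant ℓ × Utility ℓ

lemma orthant.coord_nonneg (x : orthant ℓ) (h : Fin ℓ) : 0 ≤ (x : EuclideanSpace ℝ (Fin ℓ)) h :=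
  x.2 h

lemma orthant.ext_coord {x y : orthant ℓ}
    (h : ∀ j, (x : EuclideanSpace ℝ (Fin ℓ)) j = (y : EuclideanSpace ℝ (Fin ℓ)) j) : x = y :=
  Subtype.ext (by ext j; exact h j)

/-- The element of the orthant with given nonnegative coordinates. -/
def orthant.mk (f : Fin ℓ → ℝ) (hf : ∀ h, 0 ≤ f h) : orthant ℓ :=
  ⟨WithLp.toLp 2 f, hf⟩

lemma orthant.continuous_mk {X : Type*} [TopologicalSpace X] {f : X → Fin ℓ → ℝ}
    (hf : ∀ x h, 0 ≤ f x h) (hc : ∀ h, Continuous fun x => f x h) :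
    Continuous fun x => orthant.mk (f x) (hf x) :=
  Continuous.subtype_mk ((PiLp.continuous_toLp 2 _).comp (continuous_pi hc)) _

lemma orthant.continuous_coord (h : Fin ℓ) :
    Continuous fun x : orthant ℓ => (x : EuclideanSpace ℝ (Fin ℓ)) h := by
  fun_prop

lemma Utility.lt_of_le_of_ne (u : Utility ℓ) {x y : orthant ℓ}
    (hxy : ∀ h, (x : EuclideanSpace ℝ (Fin ℓ)) h ≤ (y : EuclideanSpace ℝ (Fin ℓ)) h)
    (hne : x ≠ y) : u.1 x < u.1 y := by
  have hy : x + orthant.mk (fun h => (y : EuclideanSpace ℝ (Fin ℓ)) h -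
      (x : EuclideanSpace ℝ (Fin ℓ)) h) (fun h => sub_nonneg.2 (hxy h)) = y :=
    orthant.ext_coord fun j => by
      change (x : EuclideanSpace ℝ (Fin ℓ)) j + (_ - _) = _
      ring
  rw [← hy]
  refine u.2 x _ fun h0 => hne ?_
  rwa [h0, add_zero] at hy

lemma Utility.mono (u : Utility ℓ) {x y : orthant ℓ}
    (hxy : ∀ h, (x : EuclideanSpace ℝ (Fin ℓ)) h ≤ (y : EuclideanSpace ℝ (Fin ℓ)) h) :
    u.1 x ≤ u.1 y := by
  rcases eq_or_ne x y with rfl | hne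
  · rfl
  · exact (u.lt_of_le_of_ne hxy hne).le

lemma PriceSimplex.nonempty_fin (p : PriceSimplex ℓ) : Nonempty (Fin ℓ) := by
  by_contra h
  rw [not_nonempty_iff] at h
  simpa using p.2.2

lemma minPrice_le (p : PriceSimplex ℓ) (h : Fin ℓ) :
    minPrice p ≤ (p : EuclideanSpace ℝ (Fin ℓ)) h :=
  ciInf_le (Set.finite_range _).bddBelow h

lemma minPrice_pos (p : PriceSimplex ℓ) : 0 < minPrice p := by
  have := p.nonempty_fin
  obtain ⟨h, hh⟩ := Finite.exists_min fun h => (p : EuclideanSpace ℝ (Fin ℓ)) h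
  exact (p.2.1 h).trans_le (le_ciInf hh)

lemma continuous_minPrice : Continuous (minPrice : PriceSimplex ℓ → ℝ) := by
  rcases isEmpty_or_nonempty (Fin ℓ) with hℓ | hℓ
  · have : IsEmpty (PriceSimplex ℓ) := ⟨fun p => (p.nonempty_fin).elim hℓ.elim⟩
    exact continuous_of_const fun p => isEmptyElim p
  · have : (minPrice : PriceSimplex ℓ → ℝ) = fun p : PriceSimplex ℓ =>
        Finset.univ.inf' Finset.univ_nonempty fun h => (p : EuclideanSpace ℝ (Fin ℓ)) h := by
      ext p
      rw [Finset.inf'_univ_eq_ciInf]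
      rfl
    rw [this]
    exact Continuous.finset_inf'_apply _ fun h _ => by fun_prop

lemma PriceSimplex.le_one (p : PriceSimplex ℓ) (h : Fin ℓ) :
    (p : EuclideanSpace ℝ (Fin ℓ)) h ≤ 1 := by
  exact (Finset.single_le_sum (fun k _ => (p.2.1 k).le) (Finset.mem_univ h)).trans_eq p.2.2

lemma inner_eq_sum_mul (x y : EuclideanSpace ℝ (Fin ℓ)) : inner ℝ x y = ∑ h, x h * y h := by
  simp [PiLp.inner_apply, mul_comm]

/-- The upper corner of the box of bundles considered at prices `p` with endowment `e`. -/
noncomputable def boxCorner (e : orthant ℓ) (p : PriceSimplex ℓ) : orthant ℓ :=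
  orthant.mk (fun _ => (1 / minPrice p) * ∑ h, (e : EuclideanSpace ℝ (Fin ℓ)) h) fun _ =>
    mul_nonneg (one_div_nonneg.2 (minPrice_pos p).le)
      (Finset.sum_nonneg fun h _ => orthant.coord_nonneg e h)

lemma continuous_boxCorner :
    Continuous fun z : orthant ℓ × PriceSimplex ℓ => boxCorner z.1 z.2 := by
  refine orthant.continuous_mk _ fun h => Continuous.mul ?_ ?_
  · exact continuous_const.div (continuous_minPrice.comp continuous_snd) fun z =>
      (minPrice_pos z.2).ne'
  · fun_prop

/-- The preferred set of an agent. -/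
def Agent.preferred (d : Agent ℓ) (p : PriceSimplex ℓ) : Set (orthant ℓ) :=
  preferredSet (T := Agent ℓ) (Ω := Unit) (fun d _ => d.1) (fun d _ => d.2.1) d () p

/-- Bundles exhausting the share `z h` of the budget on the good `h`. -/
noncomputable def budgetBundle (z : Fin ℓ → ℝ) (e : orthant ℓ) (p : PriceSimplex ℓ) : orthant ℓ :=
  orthant.mk (fun h => (∑ k, (p : EuclideanSpace ℝ (Fin ℓ)) k * (e : EuclideanSpace ℝ (Fin ℓ)) k) *
    (|z h| / (p : EuclideanSpace ℝ (Fin ℓ)) h)) fun h =>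
      mul_nonneg (Finset.sum_nonneg fun k _ => mul_nonneg (p.2.1 k).le (orthant.coord_nonneg e k))
        (div_nonneg (abs_nonneg _) (p.2.1 h).le)

lemma continuous_budgetBundle :
    Continuous fun w : (Fin ℓ → ℝ) × orthant ℓ × PriceSimplex ℓ =>
      budgetBundle w.1 w.2.1 w.2.2 := by
  refine orthant.continuous_mk _ fun h => Continuous.mul (by fun_prop) ?_
  refine Continuous.div (by fun_prop) (by fun_prop) fun w => (w.2.2.2.1 h).ne'

/-- Budget shares. -/
def budgetShares (ℓ : ℕ) : Set (Fin ℓ → ℝ) :=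
  {z | (∀ h, 0 ≤ z h) ∧ ∑ h, z h ≤ 1}

lemma isCompact_budgetShares (ℓ : ℕ) : IsCompact (budgetShares ℓ) := by
  refine (isCompact_Icc (a := (0 : Fin ℓ → ℝ)) (b := 1)).of_isClosed_subset ?_ ?_
  · rw [budgetShares, ofPred_and, ofPred_forall]
    exact (isClosed_iInter fun h => isClosed_le continuous_const (by fun_prop)).inter
      (isClosed_le (by fun_prop) continuous_const)
  · intro z hz
    exact ⟨hz.1, fun h => (Finset.single_le_sum (fun k _ => hz.1 k) (Finset.mem_univ h)).trans hz.2⟩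

/-- Expenditure shares parametrize the budget set by a compact set independent of endowment and
price, so quantifying over budgets becomes quantifying over a fixed compact set. -/
lemma forall_budget_iff (e : orthant ℓ) (p : PriceSimplex ℓ) (P : orthant ℓ → Prop) :
    (∀ x : orthant ℓ, inner ℝ (p : EuclideanSpace ℝ (Fin ℓ)) (x : EuclideanSpace ℝ (Fin ℓ)) ≤
      inner ℝ (p : EuclideanSpace ℝ (Fin ℓ)) (e : EuclideanSpace ℝ (Fin ℓ)) → P x) ↔
      ∀ z ∈ budgetShares ℓ, P (budgetBundle z e p) := by
  have hw : 0 ≤ ∑ k, (p : EuclideanSpace ℝ (Fin ℓ)) k * (e : EuclideanSpace ℝ (Fin ℓ)) k :=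
    Finset.sum_nonneg fun k _ => mul_nonneg (p.2.1 k).le (orthant.coord_nonneg e k)
  simp only [inner_eq_sum_mul]
  constructor
  · intro H z hz
    refine H _ ?_
    calc _ = ∑ h, (∑ k, (p : EuclideanSpace ℝ (Fin ℓ)) k * (e : EuclideanSpace ℝ (Fin ℓ)) k) *
          z h := Finset.sum_congr rfl fun h _ => by
            change _ * (_ * (|z h| / _)) = _
            rw [abs_of_nonneg (hz.1 h)]
            field_simp [(p.2.1 h).ne']
      _ ≤ _ := by
        rw [← Finset.mul_sum]
        exact mul_le_of_le_one_right hw hz.2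
  · intro H x hx
    have hpx : ∀ h, 0 ≤ (p : EuclideanSpace ℝ (Fin ℓ)) h * (x : EuclideanSpace ℝ (Fin ℓ)) h :=
      fun h => mul_nonneg (p.2.1 h).le (orthant.coord_nonneg x h)
    set w := ∑ k, (p : EuclideanSpace ℝ (Fin ℓ)) k * (e : EuclideanSpace ℝ (Fin ℓ)) k with hwd
    have hmem : (fun h => (p : EuclideanSpace ℝ (Fin ℓ)) h *
        (x : EuclideanSpace ℝ (Fin ℓ)) h / w) ∈ budgetShares ℓ := by
      refine ⟨fun h => div_nonneg (hpx h) hw, ?_⟩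
      rw [← Finset.sum_div]
      exact div_le_one_of_le₀ hx hw
    convert! H _ hmem
    refine orthant.ext_coord fun h => ?_
    change _ = w * (|(p : EuclideanSpace ℝ (Fin ℓ)) h * (x : EuclideanSpace ℝ (Fin ℓ)) h / w| /
      (p : EuclideanSpace ℝ (Fin ℓ)) h)
    have hp := (p.2.1 h).ne'
    rw [abs_of_nonneg (div_nonneg (hpx h) hw)]
    -- With zero wealth the only affordable bundle is `0`, and it is the bundle assigned to every
    -- share vector.
    rcases eq_or_ne w 0 with h0 | h0
    · have h1 : (p : EuclideanSpace ℝ (Fin ℓ)) h * (x : EuclideanSpace ℝ (Fin ℓ)) h = 0 :=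
        le_antisymm ((Finset.single_le_sum (fun k _ => hpx k) (Finset.mem_univ h)).trans
          (hx.trans h0.le)) (hpx h)
      rw [h0, zero_mul]
      exact (mul_eq_zero.1 h1).resolve_left hp
    · field_simp

lemma Agent.mem_preferred {d : Agent ℓ} {p : PriceSimplex ℓ} {y : orthant ℓ} :
    y ∈ d.preferred p ↔ (∀ z ∈ budgetShares ℓ, d.2.1 (budgetBundle z d.1 p) ≤ d.2.1 y) ∧
      ∀ h, (y : EuclideanSpace ℝ (Fin ℓ)) h ≤
        (boxCorner d.1 p : EuclideanSpace ℝ (Fin ℓ)) h := by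
  rw [← forall_budget_iff d.1 p fun x => d.2.1 x ≤ d.2.1 y]
  rfl

/-- For each fixed share vector the defining inequality is closed, because evaluation of utilities
on the locally compact orthant is jointly continuous. -/
lemma Agent.isClosed_preferred :
    IsClosed {w : Agent ℓ × PriceSimplex ℓ × orthant ℓ | w.2.2 ∈ w.1.preferred w.2.1} := by
  simp only [Agent.mem_preferred, ofPred_and, ofPred_forall]
  refine (isClosed_iInter fun z => isClosed_iInter fun _ => ?_).inter (isClosed_iInter fun h => ?_)
  · refine isClosed_le ?_ ?_
    · have := (continuous_budgetBundle (ℓ := ℓ)).comp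
        (f := fun w : Agent ℓ × PriceSimplex ℓ × orthant ℓ => (z, w.1.1, w.2.1)) (by fun_prop)
      exact (continuous_subtype_val.comp (continuous_snd.comp continuous_fst)).eval this
    · exact (continuous_subtype_val.comp (continuous_snd.comp continuous_fst)).eval
        (continuous_snd.comp continuous_snd)
  · refine isClosed_le (by fun_prop) ?_
    exact (orthant.continuous_coord h).comp (continuous_boxCorner.comp
      (f := fun w : Agent ℓ × PriceSimplex ℓ × orthant ℓ => (w.1.1, w.2.1)) (by fun_prop))

lemma le_boxCorner_of_budget {e x : orthant ℓ} {p : PriceSimplex ℓ}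
    (hx : inner ℝ (p : EuclideanSpace ℝ (Fin ℓ)) (x : EuclideanSpace ℝ (Fin ℓ)) ≤
      inner ℝ (p : EuclideanSpace ℝ (Fin ℓ)) (e : EuclideanSpace ℝ (Fin ℓ))) (h : Fin ℓ) :
    (x : EuclideanSpace ℝ (Fin ℓ)) h ≤ (boxCorner e p : EuclideanSpace ℝ (Fin ℓ)) h := by
  rw [inner_eq_sum_mul, inner_eq_sum_mul] at hx
  change _ ≤ (1 / minPrice p) * _
  rw [one_div, ← div_eq_inv_mul, le_div_iff₀ (minPrice_pos p), mul_comm]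
  calc _ ≤ (p : EuclideanSpace ℝ (Fin ℓ)) h * (x : EuclideanSpace ℝ (Fin ℓ)) h :=
        mul_le_mul_of_nonneg_right (minPrice_le p h) (orthant.coord_nonneg x h)
    _ ≤ _ := (Finset.single_le_sum
        (f := fun h => (p : EuclideanSpace ℝ (Fin ℓ)) h * (x : EuclideanSpace ℝ (Fin ℓ)) h)
        (fun k _ => mul_nonneg (p.2.1 k).le (orthant.coord_nonneg x k))
        (Finset.mem_univ h)).trans hx
    _ ≤ _ := Finset.sum_le_sum fun k _ =>
      mul_le_of_le_one_left (orthant.coord_nonneg e k) (p.le_one k)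

lemma Agent.boxCorner_mem_preferred (d : Agent ℓ) (p : PriceSimplex ℓ) :
    boxCorner d.1 p ∈ d.preferred p :=
  ⟨fun _ hx => d.2.mono fun h => le_boxCorner_of_budget hx h, fun _ => le_rfl⟩

/-- A bundle strictly better than a preferred one beats every budget bundle strictly. Compactness of
the share set makes this open condition uniform over the budget. -/
lemma Agent.eventually_mem_preferred {d : ℕ → Agent ℓ} {d₀ : Agent ℓ} {p : ℕ → PriceSimplex ℓ}
    {p₀ : PriceSimplex ℓ} {y : ℕ → orthant ℓ} {x y₀ : orthant ℓ} (hd : Tendsto d atTop (𝓝 d₀))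
    (hp : Tendsto p atTop (𝓝 p₀)) (hy : Tendsto y atTop (𝓝 y₀)) (hx : x ∈ d₀.preferred p₀)
    (hxy : d₀.2.1 x < d₀.2.1 y₀)
    (hbox : ∀ n h, (y n : EuclideanSpace ℝ (Fin ℓ)) h ≤
      (boxCorner (d n).1 (p n) : EuclideanSpace ℝ (Fin ℓ)) h) :
    ∀ᶠ n in atTop, y n ∈ (d n).preferred (p n) := by
  have key : ∀ᶠ w : Agent ℓ × PriceSimplex ℓ × orthant ℓ in 𝓝 (d₀, p₀, y₀),
      ∀ z ∈ budgetShares ℓ, w.1.2.1 (budgetBundle z w.1.1 w.2.1) < w.1.2.1 w.2.2 := by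
    refine (isCompact_budgetShares ℓ).eventually_forall_of_forall_eventually fun z hz => ?_
    have hc1 : Continuous fun w : (Agent ℓ × PriceSimplex ℓ × orthant ℓ) × (Fin ℓ → ℝ) =>
        w.1.1.2.1 (budgetBundle w.2 w.1.1.1 w.1.2.1) := by
      have := (continuous_budgetBundle (ℓ := ℓ)).comp
        (f := fun w : (Agent ℓ × PriceSimplex ℓ × orthant ℓ) × (Fin ℓ → ℝ) =>
          (w.2, w.1.1.1, w.1.2.1)) (by fun_prop)
      exact (continuous_subtype_val.comp (continuous_snd.comp
        (continuous_fst.comp continuous_fst))).eval this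
    have hc2 : Continuous fun w : (Agent ℓ × PriceSimplex ℓ × orthant ℓ) × (Fin ℓ → ℝ) =>
        w.1.1.2.1 w.1.2.2 :=
      (continuous_subtype_val.comp (continuous_snd.comp
        (continuous_fst.comp continuous_fst))).eval
          (continuous_snd.comp (continuous_snd.comp continuous_fst))
    exact (isOpen_lt hc1 hc2).mem_nhds (((Agent.mem_preferred.1 hx).1 z hz).trans_lt hxy)
  filter_upwards [(hd.prodMk_nhds (hp.prodMk_nhds hy)).eventually key] with n hn
  exact Agent.mem_preferred.2 ⟨fun z hz => (hn z hz).le, hbox n⟩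

/-- The sum of the coordinates of the endowment. -/
def Agent.wealth (d : Agent ℓ) : ℝ :=
  ∑ h, (d.1 : EuclideanSpace ℝ (Fin ℓ)) h

lemma boxCorner_coord (d : Agent ℓ) (p : PriceSimplex ℓ) (h : Fin ℓ) :
    (boxCorner d.1 p : EuclideanSpace ℝ (Fin ℓ)) h = (1 / minPrice p) * d.wealth := rfl

attribute [irreducible] boxCorner

end Agents

/-! ### Aggregate preferred sets and upper hemicontinuity. -/

section Aggregate

variable {T : Type*} [MeasurableSpace T] {μ : Measure T} {ℓ : ℕ}

/-- The Aumann integral of the preferred sets of a family of agents. -/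
def aggregatePreferred (μ : Measure T) (d : T → Agent ℓ) (p : PriceSimplex ℓ) :
    Set (EuclideanSpace ℝ (Fin ℓ)) :=
  aumannIntegral μ fun t => (fun x : orthant ℓ => (x : EuclideanSpace ℝ (Fin ℓ))) ''
    (d t).preferred p

lemma Agent.wealth_nonneg (d : Agent ℓ) : 0 ≤ d.wealth :=
  Finset.sum_nonneg fun h _ => orthant.coord_nonneg d.1 h

lemma Agent.continuous_wealth : Continuous (Agent.wealth : Agent ℓ → ℝ) := by
  unfold Agent.wealth
  fun_prop

lemma norm_le_sum_abs (x : EuclideanSpace ℝ (Fin ℓ)) : ‖x‖ ≤ ∑ h, |x h| := by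
  conv_lhs => rw [← (EuclideanSpace.basisFun (Fin ℓ) ℝ).sum_repr x]
  refine (norm_sum_le _ _).trans (Finset.sum_le_sum fun h _ => ?_)
  simp [norm_smul]

lemma orthant.norm_le_of_coord_le {x : orthant ℓ} {c : ℝ}
    (hx : ∀ h, (x : EuclideanSpace ℝ (Fin ℓ)) h ≤ c) :
    ‖(x : EuclideanSpace ℝ (Fin ℓ))‖ ≤ ℓ * c := by
  refine (norm_le_sum_abs _).trans ?_
  calc _ ≤ ∑ _h : Fin ℓ, c := Finset.sum_le_sum fun h _ => by
        rw [abs_of_nonneg (orthant.coord_nonneg x h)]; exact hx h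
    _ = _ := by simp

lemma integrable_of_mem_preferred {d : T → Agent ℓ}
    (hi : Integrable (fun t => (d t).wealth) μ) {p : PriceSimplex ℓ} {f : T → orthant ℓ}
    (hf : Measurable f) (hfp : ∀ᵐ t ∂μ, f t ∈ (d t).preferred p) :
    Integrable (fun t => (f t : EuclideanSpace ℝ (Fin ℓ))) μ := by
  refine ((hi.const_mul (1 / minPrice p)).const_mul (ℓ : ℝ)).mono'
    (measurable_subtype_coe.comp hf).aestronglyMeasurable ?_
  filter_upwards [hfp] with t ht
  exact orthant.norm_le_of_coord_le fun h =>
    ((Agent.mem_preferred.1 ht).2 h).trans_eq (boxCorner_coord _ _ h)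

lemma mem_aggregatePreferred_of_selection {d : T → Agent ℓ}
    (hi : Integrable (fun t => (d t).wealth) μ) {p : PriceSimplex ℓ} {f : T → orthant ℓ}
    (hf : Measurable f) (hfp : ∀ᵐ t ∂μ, f t ∈ (d t).preferred p) :
    ∫ t, (f t : EuclideanSpace ℝ (Fin ℓ)) ∂μ ∈ aggregatePreferred μ d p :=
  ⟨_, integrable_of_mem_preferred hi hf hfp, hfp.mono fun _ ht => ⟨_, ht, rfl⟩, rfl⟩

/-- A measurable representative of the integrable selection, cut off at `0` coordinatewise, takes
values in the orthant everywhere and agrees with the selection a.e. -/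
lemma exists_measurable_selection {d : T → Agent ℓ} {p : PriceSimplex ℓ}
    {v : EuclideanSpace ℝ (Fin ℓ)} (hv : v ∈ aggregatePreferred μ d p) :
    ∃ f : T → orthant ℓ, Measurable f ∧ (∀ᵐ t ∂μ, f t ∈ (d t).preferred p) ∧
      ∫ t, (f t : EuclideanSpace ℝ (Fin ℓ)) ∂μ = v := by
  obtain ⟨f, hfi, hf, rfl⟩ := hv
  have hm := hfi.aestronglyMeasurable
  have hmk : ∀ h, Measurable fun t => hm.mk f t h := fun h =>
    (EuclideanSpace.proj (𝕜 := ℝ) h : EuclideanSpace ℝ (Fin ℓ) →L[ℝ] ℝ).continuous.measurable.comp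
      hm.stronglyMeasurable_mk.measurable
  have hc : ∀ᵐ t ∂μ, ∃ x : orthant ℓ, x ∈ (d t).preferred p ∧
      (x : EuclideanSpace ℝ (Fin ℓ)) = f t ∧
      orthant.mk (fun h => max 0 (hm.mk f t h)) (fun h => le_max_left _ _) = x := by
    filter_upwards [hf, hm.ae_eq_mk] with t ⟨x, hx, hxf⟩ h2
    refine ⟨x, hx, hxf, orthant.ext_coord fun h => ?_⟩
    change max 0 (hm.mk f t h) = _
    rw [← h2, ← hxf, max_eq_right (orthant.coord_nonneg x h)]
  refine ⟨fun t => orthant.mk (fun h => max 0 (hm.mk f t h)) fun h => le_max_left _ _,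
    ?_, ?_, ?_⟩
  · refine Measurable.subtype_mk ?_
    exact (PiLp.continuous_toLp 2 _).measurable.comp
      (measurable_pi_lambda _ fun h => measurable_const.max (hmk h))
  · filter_upwards [hc] with t ⟨x, hx, _, h3⟩
    rwa [h3]
  · refine integral_congr_ae ?_
    filter_upwards [hc] with t ⟨x, _, h2, h3⟩
    rw [h3, h2]

lemma coe_mem_orthant_of_mem_aggregate {d : T → Agent ℓ}
    (hi : Integrable (fun t => (d t).wealth) μ) {p : PriceSimplex ℓ}
    {v : EuclideanSpace ℝ (Fin ℓ)} (hv : v ∈ aggregatePreferred μ d p) :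
    v ∈ orthant ℓ ∧ ‖v‖ ≤ ℓ * ((1 / minPrice p) * ∫ t, (d t).wealth ∂μ) := by
  obtain ⟨f, hf, hfp, rfl⟩ := exists_measurable_selection hv
  have hfi := integrable_of_mem_preferred hi hf hfp
  constructor
  · intro h
    rw [eval_integral_piLp (integrable_piLp_iff.1 hfi)]
    exact integral_nonneg fun t => orthant.coord_nonneg (f t) h
  · rw [← integral_const_mul, ← integral_const_mul]
    refine norm_integral_le_of_norm_le ((hi.const_mul _).const_mul _) ?_
    filter_upwards [hfp] with t ht
    exact orthant.norm_le_of_coord_le fun h =>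
    ((Agent.mem_preferred.1 ht).2 h).trans_eq (boxCorner_coord _ _ h)

lemma measurable_boxCorner {d : T → Agent ℓ} (hd : Measurable d) (p : PriceSimplex ℓ) :
    Measurable fun t => boxCorner (d t).1 p := by
  have h1 : Continuous fun e : orthant ℓ => boxCorner e p :=
    continuous_boxCorner.comp (f := fun e : orthant ℓ => (e, p)) (by fun_prop)
  exact h1.measurable.comp hd.fst

lemma boxCorner_mem_aggregate {d : T → Agent ℓ} (hd : Measurable d)
    (hi : Integrable (fun t => (d t).wealth) μ) (p : PriceSimplex ℓ) :
    ∫ t, (boxCorner (d t).1 p : EuclideanSpace ℝ (Fin ℓ)) ∂μ ∈ aggregatePreferred μ d p :=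
  mem_aggregatePreferred_of_selection hi (measurable_boxCorner hd p)
    (Eventually.of_forall fun t => (d t).boxCorner_mem_preferred p)

lemma exists_inv_minPrice_le {p : ℕ → PriceSimplex ℓ} {p₀ : PriceSimplex ℓ}
    (hp : Tendsto p atTop (𝓝 p₀)) : ∃ C : ℝ, 0 ≤ C ∧ ∀ n, 1 / minPrice (p n) ≤ C := by
  have h : Tendsto (fun n => 1 / minPrice (p n)) atTop (𝓝 (1 / minPrice p₀)) :=
    tendsto_const_nhds.div (continuous_minPrice.continuousAt.tendsto.comp hp) (minPrice_pos p₀).ne'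
  obtain ⟨C, hC⟩ := h.bddAbove_range
  exact ⟨C, (one_div_nonneg.2 (minPrice_pos (p 0)).le).trans (hC ⟨0, rfl⟩), fun n => hC ⟨n, rfl⟩⟩

/-- A dominated sequence of economies converging pointwise, together with prices. -/
structure EconomyTendsto (μ : Measure T) (d : ℕ → T → Agent ℓ) (d₀ : T → Agent ℓ)
    (p : ℕ → PriceSimplex ℓ) (p₀ : PriceSimplex ℓ) (G : T → ℝ) : Prop where
  measurable : ∀ n, Measurable (d n)
  measurable_limit : Measurable d₀
  tendsto : ∀ t, Tendsto (fun n => d n t) atTop (𝓝 (d₀ t))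
  tendsto_price : Tendsto p atTop (𝓝 p₀)
  measurable_bound : Measurable G
  integrable_bound : Integrable G μ
  wealth_le : ∀ n t, (d n t).wealth ≤ G t

namespace EconomyTendsto

variable {d : ℕ → T → Agent ℓ} {d₀ : T → Agent ℓ} {p : ℕ → PriceSimplex ℓ}
  {p₀ : PriceSimplex ℓ} {G : T → ℝ}

lemma comp (H : EconomyTendsto μ d d₀ p p₀ G) {ψ : ℕ → ℕ} (hψ : StrictMono ψ) :
    EconomyTendsto μ (d ∘ ψ) d₀ (p ∘ ψ) p₀ G :=
  ⟨fun _ => H.1 _, H.2, fun t => (H.3 t).comp hψ.tendsto_atTop, H.4.comp hψ.tendsto_atTop,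
    H.5, H.6, fun _ => H.7 _⟩

lemma integrable_wealth (H : EconomyTendsto μ d d₀ p p₀ G) (n : ℕ) :
    Integrable (fun t => (d n t).wealth) μ :=
  H.6.mono' (Agent.continuous_wealth.measurable.comp (H.1 n)).aestronglyMeasurable <|
    Eventually.of_forall fun t => by
      rw [Real.norm_eq_abs, abs_of_nonneg (Agent.wealth_nonneg _)]; exact H.7 n t

lemma wealth_limit_le (H : EconomyTendsto μ d d₀ p p₀ G) (t : T) : (d₀ t).wealth ≤ G t :=
  le_of_tendsto ((Agent.continuous_wealth.tendsto _).comp (H.3 t))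
    (Eventually.of_forall fun n => H.7 n t)

lemma integrable_wealth_limit (H : EconomyTendsto μ d d₀ p p₀ G) :
    Integrable (fun t => (d₀ t).wealth) μ :=
  H.6.mono' (Agent.continuous_wealth.measurable.comp H.2).aestronglyMeasurable <|
    Eventually.of_forall fun t => by
      rw [Real.norm_eq_abs, abs_of_nonneg (Agent.wealth_nonneg _)]; exact H.wealth_limit_le t

lemma exists_bound (H : EconomyTendsto μ d d₀ p p₀ G) : ∃ W : T → ℝ, Measurable W ∧
    Integrable W μ ∧ ∀ n t h, (boxCorner (d n t).1 (p n) : EuclideanSpace ℝ (Fin ℓ)) h ≤ W t := by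
  obtain ⟨C, hC0, hC⟩ := exists_inv_minPrice_le H.4
  refine ⟨fun t => C * G t, H.5.const_mul C, H.6.const_mul C, fun n t h => ?_⟩
  rw [boxCorner_coord]
  exact mul_le_mul (hC n) (H.7 n t) (Agent.wealth_nonneg _) hC0

/-- Upper hemicontinuity of the aggregate preferred set. -/
lemma mem_aggregate_of_tendsto [IsFiniteMeasure μ] (H : EconomyTendsto μ d d₀ p p₀ G)
    {v : ℕ → EuclideanSpace ℝ (Fin ℓ)} {v₀ : EuclideanSpace ℝ (Fin ℓ)}
    (hv : ∀ n, v n ∈ aggregatePreferred μ (d n) (p n)) (hvv : Tendsto v atTop (𝓝 v₀)) :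
    v₀ ∈ aggregatePreferred μ d₀ p₀ := by
  have := p₀.nonempty_fin
  choose f hf hfp hfv using fun n => exists_measurable_selection (hv n)
  obtain ⟨W, hWm, hWi, hW⟩ := H.exists_bound
  obtain ⟨g, hg, hgv, hgc⟩ := exists_cluster_integral hWm hWi (v := v₀)
    (f := fun n t => (f n t : EuclideanSpace ℝ (Fin ℓ)))
    (fun n => (measurable_subtype_coe.comp (hf n)).aestronglyMeasurable)
    (fun n => by
      filter_upwards [hfp n] with t ht h
      exact ⟨orthant.coord_nonneg _ h, ((Agent.mem_preferred.1 ht).2 h).trans (hW n t h)⟩)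
    (by simpa only [hfv] using hvv)
  refine ⟨g, hg, ?_, hgv⟩
  filter_upwards [hgc, ae_all_iff.2 hfp] with t h1 h2
  -- The subsequence depends on `t`, which is harmless: only the closed graph at this `t` is used.
  obtain ⟨ψ, hψ, hψg⟩ := h1.tendsto_subseq
  have h3 : g t ∈ orthant ℓ := (orthant.isClosed ℓ).mem_of_tendsto hψg
    (Eventually.of_forall fun n => (f (ψ n) t).2)
  refine ⟨⟨g t, h3⟩, ?_, rfl⟩
  have h4 : Tendsto (fun n => f (ψ n) t) atTop (𝓝 (⟨g t, h3⟩ : orthant ℓ)) :=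
    tendsto_subtype_rng.2 hψg
  exact Agent.isClosed_preferred.mem_of_tendsto
    (((H.3 t).comp hψ.tendsto_atTop).prodMk_nhds
      ((H.4.comp hψ.tendsto_atTop).prodMk_nhds h4))
    (Eventually.of_forall fun n => h2 (ψ n))

end EconomyTendsto

end Aggregate

/-! ### Lower hemicontinuity by mixing with the corner of the box. -/

section LowerHemicontinuity

variable {T : Type*} [MeasurableSpace T] {μ : Measure T} {ℓ : ℕ}

/-- The convex combination of `min x b` and `b` with weight `ε` on `b`. -/
def orthant.mix (ε : ℝ) (hε : 0 ≤ ε ∧ ε ≤ 1) (x b : orthant ℓ) : orthant ℓ :=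
  orthant.mk (fun h => (1 - ε) * min ((x : EuclideanSpace ℝ (Fin ℓ)) h)
    ((b : EuclideanSpace ℝ (Fin ℓ)) h) + ε * (b : EuclideanSpace ℝ (Fin ℓ)) h) fun h =>
      add_nonneg (mul_nonneg (sub_nonneg.2 hε.2)
        (le_min (orthant.coord_nonneg x h) (orthant.coord_nonneg b h)))
        (mul_nonneg hε.1 (orthant.coord_nonneg b h))

lemma orthant.continuous_mix {ε : ℝ} (hε : 0 ≤ ε ∧ ε ≤ 1) :
    Continuous fun z : orthant ℓ × orthant ℓ => orthant.mix ε hε z.1 z.2 :=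
  orthant.continuous_mk _ fun h => by fun_prop

lemma orthant.measurable_mix {ε : ℝ} (hε : 0 ≤ ε ∧ ε ≤ 1) {f g : T → orthant ℓ}
    (hf : Measurable f) (hg : Measurable g) :
    Measurable fun t => orthant.mix ε hε (f t) (g t) := by
  have h := (orthant.continuous_mix (ℓ := ℓ) hε).measurable
  exact h.comp (hf.prodMk hg)

lemma orthant.mix_coord {ε : ℝ} (hε : 0 ≤ ε ∧ ε ≤ 1) (x b : orthant ℓ) (h : Fin ℓ) :
    (orthant.mix ε hε x b : EuclideanSpace ℝ (Fin ℓ)) h =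
      (1 - ε) * min ((x : EuclideanSpace ℝ (Fin ℓ)) h) ((b : EuclideanSpace ℝ (Fin ℓ)) h) +
        ε * (b : EuclideanSpace ℝ (Fin ℓ)) h := rfl

lemma orthant.mix_le {ε : ℝ} (hε : 0 ≤ ε ∧ ε ≤ 1) (x b : orthant ℓ) (h : Fin ℓ) :
    (orthant.mix ε hε x b : EuclideanSpace ℝ (Fin ℓ)) h ≤ (b : EuclideanSpace ℝ (Fin ℓ)) h := by
  rw [orthant.mix_coord]
  have := mul_le_mul_of_nonneg_left (min_le_right ((x : EuclideanSpace ℝ (Fin ℓ)) h)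
    ((b : EuclideanSpace ℝ (Fin ℓ)) h)) (sub_nonneg.2 hε.2)
  linarith

lemma orthant.coe_mix {ε : ℝ} (hε : 0 ≤ ε ∧ ε ≤ 1) {x b : orthant ℓ}
    (hxb : ∀ h, (x : EuclideanSpace ℝ (Fin ℓ)) h ≤ (b : EuclideanSpace ℝ (Fin ℓ)) h) :
    (orthant.mix ε hε x b : EuclideanSpace ℝ (Fin ℓ)) =
      (1 - ε) • (x : EuclideanSpace ℝ (Fin ℓ)) + ε • (b : EuclideanSpace ℝ (Fin ℓ)) := by
  ext h
  rw [orthant.mix_coord, min_eq_left (hxb h)]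
  simp

lemma orthant.le_mix {ε : ℝ} (hε : 0 ≤ ε ∧ ε ≤ 1) {x b : orthant ℓ}
    (hxb : ∀ h, (x : EuclideanSpace ℝ (Fin ℓ)) h ≤ (b : EuclideanSpace ℝ (Fin ℓ)) h) (h : Fin ℓ) :
    (x : EuclideanSpace ℝ (Fin ℓ)) h ≤ (orthant.mix ε hε x b : EuclideanSpace ℝ (Fin ℓ)) h := by
  rw [orthant.mix_coord, min_eq_left (hxb h)]
  have := mul_le_mul_of_nonneg_left (hxb h) hε.1
  linarith

lemma orthant.ne_mix {ε : ℝ} (hε : 0 ≤ ε ∧ ε ≤ 1) (hε0 : 0 < ε) {x b : orthant ℓ}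
    (hxb : ∀ h, (x : EuclideanSpace ℝ (Fin ℓ)) h ≤ (b : EuclideanSpace ℝ (Fin ℓ)) h)
    (hne : x ≠ b) : x ≠ orthant.mix ε hε x b := by
  intro H
  refine hne (orthant.ext_coord fun h => ?_)
  have h1 := congrArg (fun y : orthant ℓ => (y : EuclideanSpace ℝ (Fin ℓ)) h) H
  simp only [orthant.mix_coord, min_eq_left (hxb h)] at h1
  have h2 : ε * ((b : EuclideanSpace ℝ (Fin ℓ)) h - (x : EuclideanSpace ℝ (Fin ℓ)) h) = 0 := by
    linarith
  have := (mul_eq_zero.1 h2).resolve_left hε0.ne'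
  linarith

attribute [irreducible] orthant.mix

lemma Agent.measurableSet_preferred {d : T → Agent ℓ} (hd : Measurable d) {y : T → orthant ℓ}
    (hy : Measurable y) (p : PriceSimplex ℓ) : MeasurableSet {t | y t ∈ (d t).preferred p} := by
  have h1 : IsClosed {w : Agent ℓ × orthant ℓ | w.2 ∈ w.1.preferred p} :=
    Agent.isClosed_preferred.preimage
      (f := fun w : Agent ℓ × orthant ℓ => (w.1, p, w.2)) (by fun_prop)
  exact (hd.prodMk hy) h1.measurableSet

lemma tendsto_boxCorner {d : ℕ → Agent ℓ} {d₀ : Agent ℓ} {p : ℕ → PriceSimplex ℓ}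
    {p₀ : PriceSimplex ℓ} (hd : Tendsto d atTop (𝓝 d₀)) (hp : Tendsto p atTop (𝓝 p₀)) :
    Tendsto (fun n => boxCorner (d n).1 (p n)) atTop (𝓝 (boxCorner d₀.1 p₀)) := by
  have h1 : Tendsto (fun n => ((d n).1, p n)) atTop (𝓝 (d₀.1, p₀)) :=
    hd.fst_nhds.prodMk_nhds hp
  have h2 := (continuous_boxCorner (ℓ := ℓ)).tendsto (d₀.1, p₀)
  exact h2.comp h1

lemma orthant.tendsto_mix {ε : ℝ} (hε : 0 ≤ ε ∧ ε ≤ 1) (x : orthant ℓ) {c : ℕ → orthant ℓ}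
    {c₀ : orthant ℓ} (hc : Tendsto c atTop (𝓝 c₀)) :
    Tendsto (fun n => orthant.mix ε hε x (c n)) atTop (𝓝 (orthant.mix ε hε x c₀)) := by
  have h1 : Tendsto (fun n => (x, c n)) atTop (𝓝 (x, c₀)) := tendsto_const_nhds.prodMk_nhds hc
  have h2 := (orthant.continuous_mix (ℓ := ℓ) hε).tendsto (x, c₀)
  exact h2.comp h1

variable {d : ℕ → T → Agent ℓ} {d₀ : T → Agent ℓ} {p : ℕ → PriceSimplex ℓ}
  {p₀ : PriceSimplex ℓ} {G : T → ℝ}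

open Classical in
/-- Lower hemicontinuity of the aggregate preferred set. -/
lemma EconomyTendsto.eventually_exists_dist_lt (H : EconomyTendsto μ d d₀ p p₀ G)
    {v : EuclideanSpace ℝ (Fin ℓ)} (hv : v ∈ aggregatePreferred μ d₀ p₀) {η : ℝ} (hη : 0 < η) :
    ∀ᶠ n in atTop, ∃ w ∈ aggregatePreferred μ (d n) (p n), dist w v < η := by
  obtain ⟨f, hf, hfp, hfv⟩ := exists_measurable_selection hv
  obtain ⟨W, hWm, hWi, hW⟩ := H.exists_bound
  have hfi := integrable_of_mem_preferred H.integrable_wealth_limit hf hfp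
  set b : T → orthant ℓ := fun t => boxCorner (d₀ t).1 p₀ with hb
  have hbm : Measurable b := measurable_boxCorner H.measurable_limit p₀
  have hbp : ∀ᵐ t ∂μ, b t ∈ (d₀ t).preferred p₀ :=
    Eventually.of_forall fun t => (d₀ t).boxCorner_mem_preferred p₀
  have hbi := integrable_of_mem_preferred H.integrable_wealth_limit hbm hbp
  set β : EuclideanSpace ℝ (Fin ℓ) := ∫ t, (b t : EuclideanSpace ℝ (Fin ℓ)) ∂μ with hβ
  -- The approximating integrals will converge to `(1 - ε) v + ε β`, whose distance to `v` is `ε ‖β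
  -- - v‖`.
  obtain ⟨ε, hε0, hε1, hεη⟩ : ∃ ε : ℝ, 0 < ε ∧ ε ≤ 1 ∧ ε * ‖β - v‖ < η := by
    refine ⟨min 1 (η / (‖β - v‖ + 1)), lt_min one_pos (by positivity), min_le_left _ _, ?_⟩
    calc _ ≤ η / (‖β - v‖ + 1) * ‖β - v‖ :=
          mul_le_mul_of_nonneg_right (min_le_right _ _) (norm_nonneg _)
      _ < η / (‖β - v‖ + 1) * (‖β - v‖ + 1) :=
          mul_lt_mul_of_pos_left (lt_add_one _) (by positivity)
      _ = η := by field_simp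
  have hε : 0 ≤ ε ∧ ε ≤ 1 := ⟨hε0.le, hε1⟩
  set c : ℕ → T → orthant ℓ := fun n t => boxCorner (d n t).1 (p n) with hc
  have hcm : ∀ n, Measurable (c n) := fun n => measurable_boxCorner (H.measurable n) (p n)
  set y : ℕ → T → orthant ℓ := fun n t => orthant.mix ε hε (f t) (c n t) with hy
  have hym : ∀ n, Measurable (y n) := fun n => orthant.measurable_mix hε hf (hcm n)
  -- The mixture stays in the box of the `n`-th economy, because `orthant.mix` takes a minimum with
  -- the corner, but it need not be preferred for small `n`; the corner is always an admissible
  -- substitute.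
  set z : ℕ → T → orthant ℓ := fun n t =>
    if y n t ∈ (d n t).preferred (p n) then y n t else c n t with hz
  have hzm : ∀ n, Measurable (z n) := fun n =>
    Measurable.ite (Agent.measurableSet_preferred (H.measurable n) (hym n) (p n)) (hym n) (hcm n)
  have hzp : ∀ n t, z n t ∈ (d n t).preferred (p n) := fun n t => by
    simp only [hz]
    split_ifs with h
    · exact h
    · exact (d n t).boxCorner_mem_preferred (p n)
  have hct : ∀ t, Tendsto (fun n => c n t) atTop (𝓝 (b t)) := fun t =>
    tendsto_boxCorner (H.tendsto t) H.tendsto_price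
  have hyt : ∀ t, Tendsto (fun n => y n t) atTop (𝓝 (orthant.mix ε hε (f t) (b t))) := fun t =>
    orthant.tendsto_mix hε (f t) (hct t)
  have hzt : ∀ᵐ t ∂μ, Tendsto (fun n => (z n t : EuclideanSpace ℝ (Fin ℓ))) atTop
      (𝓝 ((1 - ε) • (f t : EuclideanSpace ℝ (Fin ℓ)) + ε • (b t : EuclideanSpace ℝ (Fin ℓ)))) := by
    filter_upwards [hfp] with t ht
    have hfb := (Agent.mem_preferred.1 ht).2
    rw [← orthant.coe_mix hε hfb]
    suffices h : Tendsto (fun n => z n t) atTop (𝓝 (orthant.mix ε hε (f t) (b t))) from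
      tendsto_subtype_rng.1 h
    -- If `f t` is the corner there is no strict improvement, but both branches of `z` converge to
    -- that corner. Otherwise the mixture is strictly better than `f t` and is eventually preferred.
    rcases eq_or_ne (f t) (b t) with hfbt | hne
    · have hmb : orthant.mix ε hε (f t) (b t) = b t := by
        refine Subtype.ext ?_
        rw [orthant.coe_mix hε hfb, hfbt, ← add_smul]
        simp
      have h1 := hyt t
      rw [hmb] at h1
      rw [hmb]
      refine tendsto_def.2 fun s hs => ?_
      filter_upwards [h1 hs, hct t hs] with n h2 h3
      simp only [hz, mem_preimage]
      split_ifs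
      · exact h2
      · exact h3
    · have h1 := Agent.eventually_mem_preferred (H.tendsto t) H.tendsto_price (hyt t) ht
        ((d₀ t).2.lt_of_le_of_ne (orthant.le_mix hε hfb) (orthant.ne_mix hε hε0 hfb hne))
        fun n h => orthant.mix_le hε _ _ h
      refine (hyt t).congr' ?_
      filter_upwards [h1] with n hn
      simp only [hz, if_pos hn]
  have hlim := tendsto_integral_of_dominated_convergence (μ := μ) (fun t => (ℓ : ℝ) * W t)
    (F := fun n t => (z n t : EuclideanSpace ℝ (Fin ℓ)))
    (fun n => (measurable_subtype_coe.comp (hzm n)).aestronglyMeasurable) (hWi.const_mul _)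
    (fun n => Eventually.of_forall fun t => orthant.norm_le_of_coord_le fun h =>
      ((Agent.mem_preferred.1 (hzp n t)).2 h).trans (hW n t h)) hzt
  have hsum : ∫ t, ((1 - ε) • (f t : EuclideanSpace ℝ (Fin ℓ)) +
      ε • (b t : EuclideanSpace ℝ (Fin ℓ))) ∂μ = (1 - ε) • v + ε • β := by
    rw [hβ, ← hfv, ← integral_smul, ← integral_smul]
    exact integral_add (hfi.smul (1 - ε)) (hbi.smul ε)
  rw [hsum] at hlim
  have hd : dist ((1 - ε) • v + ε • β) v < η := by
    rw [dist_eq_norm, show (1 - ε) • v + ε • β - v = ε • (β - v) by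
      rw [sub_smul, one_smul, smul_sub]; abel, norm_smul, Real.norm_eq_abs, abs_of_pos hε0]
    exact hεη
  filter_upwards [hlim ((isOpen_lt (continuous_id.dist continuous_const)
    continuous_const).mem_nhds hd)] with n hn
  exact ⟨_, mem_aggregatePreferred_of_selection (H.integrable_wealth n) (hzm n)
    (Eventually.of_forall (hzp n)), hn⟩

end LowerHemicontinuity

/-! ### A sequential criterion for convergence in the Hausdorff metric. -/

section HausdorffConvergence

/-- Inside a common compact set, points of `K n` staying away from `K₀` would accumulate outside
`K₀`. Conversely, a finite net of `K₀` makes the pointwise approximation uniform. -/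
lemma tendsto_nonemptyCompacts {X : Type*} [MetricSpace X]
    {K : ℕ → TopologicalSpace.NonemptyCompacts X} {K₀ : TopologicalSpace.NonemptyCompacts X}
    {S : Set X} (hS : IsCompact S) (hKS : ∀ n, (K n : Set X) ⊆ S)
    (hu : ∀ ψ : ℕ → ℕ, StrictMono ψ → ∀ (x : ℕ → X) (x₀ : X), (∀ n, x n ∈ K (ψ n)) →
      Tendsto x atTop (𝓝 x₀) → x₀ ∈ K₀)
    (hl : ∀ x ∈ K₀, ∀ η > 0, ∀ᶠ n in atTop, ∃ y ∈ K n, dist y x < η) :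
    Tendsto K atTop (𝓝 K₀) := by
  rw [Metric.tendsto_nhds]
  intro ε hε
  have h1 : ∀ᶠ n in atTop, ∀ x ∈ K n, ∃ y ∈ K₀, dist x y ≤ ε / 2 := by
    by_contra hcon
    rw [not_eventually] at hcon
    obtain ⟨ψ, hψ, hψn⟩ := extraction_of_frequently_atTop hcon
    push Not at hψn
    choose x hx hxd using hψn
    obtain ⟨x₀, -, θ, hθ, hlim⟩ := hS.tendsto_subseq fun n => hKS _ (hx n)
    have h0 : x₀ ∈ K₀ := hu (ψ ∘ θ) (hψ.comp hθ) (x ∘ θ) x₀ (fun n => hx (θ n)) hlim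
    have h2 : ∀ᶠ n in atTop, dist ((x ∘ θ) n) x₀ < ε / 2 :=
      (Metric.tendsto_nhds.1 hlim) _ (half_pos hε)
    obtain ⟨n, hn⟩ := h2.exists
    exact lt_irrefl _ (hn.trans (hxd (θ n) x₀ h0))
  have h2 : ∀ᶠ n in atTop, ∀ x ∈ K₀, ∃ y ∈ K n, dist x y ≤ ε / 2 := by
    obtain ⟨t, htK, ht⟩ := K₀.isCompact.elim_nhds_subcover (fun x => Metric.ball x (ε / 4))
      fun x _ => Metric.ball_mem_nhds x (by linarith)
    have h3 : ∀ᶠ n in atTop, ∀ x ∈ t, ∃ y ∈ K n, dist y x < ε / 4 :=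
      (Finset.eventually_all t).2 fun x hx => hl x (htK x hx) _ (by linarith)
    filter_upwards [h3] with n hn x hx
    obtain ⟨c, hct, hxc⟩ := mem_iUnion₂.1 (ht hx)
    obtain ⟨y, hy, hyc⟩ := hn c hct
    refine ⟨y, hy, ?_⟩
    have h4 := dist_triangle_right x y c
    have h5 : dist x c < ε / 4 := hxc
    linarith
  filter_upwards [h1, h2] with n h3 h4
  exact (Metric.hausdorffDist_le_of_mem_dist (half_pos hε).le h3 h4).trans_lt (half_lt_self hε)

end HausdorffConvergence

/-! ### Generating measurable maps on a product by pointwise limits. -/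

section MonotoneClass

variable {T Ω D : Type*} [MeasurableSpace T] [MeasurableSpace Ω] [MeasurableSpace D]

/-- The smallest class of functions on a product that contains the functions `G (i ω) t` with
`i` measurable into the natural numbers and is closed under sequential pointwise limits. -/
inductive SectionallyGenerated [TopologicalSpace D] : (T × Ω → D) → Prop
  | base (G : ℕ → T → D) (hG : ∀ n, Measurable (G n)) (i : Ω → ℕ) (hi : Measurable i) :
      SectionallyGenerated fun z => G (i z.2) z.1
  | lim (g : ℕ → T × Ω → D) (f : T × Ω → D) (hg : ∀ n, SectionallyGenerated (g n))
      (hf : ∀ z, Tendsto (fun n => g n z) atTop (𝓝 (f z))) : SectionallyGenerated f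

namespace SectionallyGenerated

-- Induction on both maps reduces to two generators, where the state enters through three discrete
-- data: membership in `B` and the two indices. Pairing encodes them in one natural number.
open Classical in
lemma piecewise_rectangle [TopologicalSpace D] {A : Set T} {B : Set Ω} (hA : MeasurableSet A)
    (hB : MeasurableSet B) {f g : T × Ω → D} (hf : SectionallyGenerated f)
    (hg : SectionallyGenerated g) : SectionallyGenerated ((A ×ˢ B).piecewise f g) := by
  induction hf with
  | base G hG i hi =>
    induction hg with
    | base G' hG' i' hi' =>
      let j : Ω → ℕ := fun ω => Nat.pair (if ω ∈ B then 1 else 0) (Nat.pair (i ω) (i' ω))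
      have hj : Measurable j := by
        have h1 : Measurable fun ω => (if ω ∈ B then 1 else 0 : ℕ) :=
          Measurable.ite hB measurable_const measurable_const
        exact (Measurable.of_discrete (f := fun q : ℕ × ℕ × ℕ =>
          Nat.pair q.1 (Nat.pair q.2.1 q.2.2))).comp (h1.prodMk (hi.prodMk hi'))
      convert! SectionallyGenerated.base (fun n => if n.unpair.1 = 1 then
        A.piecewise (G n.unpair.2.unpair.1) (G' n.unpair.2.unpair.2)
        else G' n.unpair.2.unpair.2) (fun n => ?_) j hj using 1
      · ext z
        by_cases hz : z.2 ∈ B <;> by_cases hz' : z.1 ∈ A <;> simp [j, piecewise, hz, hz']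
      · split_ifs
        · exact (hG _).piecewise hA (hG' _)
        · exact hG' _
    | lim g f _ hgf ih =>
      refine SectionallyGenerated.lim _ _ ih fun z => ?_
      by_cases hz : z ∈ A ×ˢ B
      · simp only [piecewise_eq_of_mem _ _ _ hz]; exact tendsto_const_nhds
      · simp only [piecewise_eq_of_notMem _ _ _ hz]; exact hgf z
  | lim g' f _ hgf ih =>
    refine SectionallyGenerated.lim _ _ ih fun z => ?_
    by_cases hz : z ∈ A ×ˢ B
    · simp only [piecewise_eq_of_mem _ _ _ hz]; exact hgf z
    · simp only [piecewise_eq_of_notMem _ _ _ hz]; exact tendsto_const_nhds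

-- Dynkin induction from rectangles: complements exchange the two maps, and a countable union is the
-- limit of its finite partial unions.
open Classical in
lemma piecewise [TopologicalSpace D] {S : Set (T × Ω)} (hS : MeasurableSet S)
    {f g : T × Ω → D} (hf : SectionallyGenerated f) (hg : SectionallyGenerated g) :
    SectionallyGenerated (S.piecewise f g) := by
  have hrect := generateFrom_prod (α := T) (β := Ω)
  induction S, hS using MeasurableSpace.induction_on_inter hrect.symm isPiSystem_prod
    generalizing f g with
  | empty => simpa using hg
  | basic S hS =>
    obtain ⟨A, hA, B, hB, rfl⟩ := hS
    convert! piecewise_rectangle hA hB hf hg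
  | compl S _ ih =>
    rw [piecewise_compl]
    exact ih hg hf
  | iUnion S _ _ ih =>
    have h1 : ∀ n, SectionallyGenerated ((⋃ k ∈ Finset.range n, S k).piecewise f g) := by
      intro n
      induction n with
      | zero =>
        convert! hg using 1
        ext z
        simp [Set.piecewise]
      | succ n ihn =>
        convert! ih n hf ihn using 1
        ext z
        by_cases hz : z ∈ S n
        · rw [piecewise_eq_of_mem _ _ _ hz, piecewise_eq_of_mem]
          exact mem_iUnion₂.2 ⟨n, by simp, hz⟩
        · rw [piecewise_eq_of_notMem _ _ _ hz]
          by_cases hz' : z ∈ ⋃ k ∈ Finset.range n, S k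
          · rw [piecewise_eq_of_mem _ _ _ hz', piecewise_eq_of_mem]
            obtain ⟨k, hk, hzk⟩ := mem_iUnion₂.1 hz'
            exact mem_iUnion₂.2 ⟨k, by simp at hk ⊢; omega, hzk⟩
          · rw [piecewise_eq_of_notMem _ _ _ hz', piecewise_eq_of_notMem]
            intro hz''
            obtain ⟨k, hk, hzk⟩ := mem_iUnion₂.1 hz''
            rcases Nat.lt_succ_iff_lt_or_eq.1 (Finset.mem_range.1 hk) with h | rfl
            · exact hz' (mem_iUnion₂.2 ⟨k, Finset.mem_range.2 h, hzk⟩)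
            · exact hz hzk
    refine SectionallyGenerated.lim _ _ h1 fun z => ?_
    by_cases hz : z ∈ ⋃ k, S k
    · obtain ⟨k, hk⟩ := mem_iUnion.1 hz
      rw [piecewise_eq_of_mem _ _ _ hz]
      refine tendsto_const_nhds.congr' ?_
      filter_upwards [eventually_gt_atTop k] with n hn
      rw [piecewise_eq_of_mem]
      exact mem_iUnion₂.2 ⟨k, by simpa using hn, hk⟩
    · rw [piecewise_eq_of_notMem _ _ _ hz]
      refine tendsto_const_nhds.congr fun n => ?_
      rw [piecewise_eq_of_notMem]
      intro h
      obtain ⟨k, _, hk⟩ := mem_iUnion₂.1 h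
      exact hz (mem_iUnion.2 ⟨k, hk⟩)

open Classical in
lemma of_countable [TopologicalSpace D] (e : ℕ → D) {i : T × Ω → ℕ} (hi : Measurable i) :
    SectionallyGenerated fun z => e (i z) := by
  have hconst : ∀ c : D, SectionallyGenerated fun _ : T × Ω => c := fun c =>
    SectionallyGenerated.base (fun _ _ => c) (fun _ => measurable_const) (fun _ => 0)
      measurable_const
  have h1 : ∀ n, SectionallyGenerated fun z => e (min (i z) n) := by
    intro n
    induction n with
    | zero => simpa using hconst (e 0)
    | succ n ih =>
      convert! ih.piecewise (S := {z | i z ≤ n}) (hi (measurableSet_Iic (a := n)))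
        (hconst (e (n + 1))) using 1
      ext z
      by_cases hz : i z ≤ n
      · simp only [Set.piecewise, mem_ofPred_eq, if_pos hz]
        rw [min_eq_left hz, min_eq_left (by omega)]
      · simp only [Set.piecewise, mem_ofPred_eq, if_neg hz]
        rw [min_eq_right (by omega)]
  refine SectionallyGenerated.lim _ _ h1 fun z => ?_
  refine tendsto_const_nhds.congr' ?_
  filter_upwards [eventually_ge_atTop (i z)] with n hn
  rw [min_eq_left hn]

-- The first point of a dense sequence within `1 / (n + 1)` of the value has measurable index, so
-- each measurable map is a limit of countably valued ones.
open Classical in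
lemma of_measurable [Nonempty D] [TopologicalSpace D] [SecondCountableTopology D]
    [TopologicalSpace.PseudoMetrizableSpace D] [OpensMeasurableSpace D] {f : T × Ω → D}
    (hf : Measurable f) : SectionallyGenerated f := by
  let := TopologicalSpace.pseudoMetrizableSpacePseudoMetric D
  obtain ⟨e, he⟩ := TopologicalSpace.exists_dense_seq D
  have hex : ∀ (n : ℕ) (z : T × Ω), ∃ k, dist (f z) (e k) < 1 / ((n : ℝ) + 1) := fun n z =>
    he.exists_dist_lt (f z) Nat.one_div_pos_of_nat
  have hm : ∀ n : ℕ, Measurable fun z => Nat.find (hex n z) := fun n =>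
    measurable_find _ fun k => measurableSet_lt (hf.dist measurable_const) measurable_const
  refine SectionallyGenerated.lim _ _ (fun n => of_countable e (hm n)) fun z => ?_
  rw [tendsto_iff_dist_tendsto_zero]
  refine squeeze_zero (fun _ => dist_nonneg) (fun n => ?_) tendsto_one_div_add_atTop_nhds_zero_nat
  rw [dist_comm]
  exact (Nat.find_spec (hex n z)).le

end SectionallyGenerated

end MonotoneClass

/-! ### Borel measurability of maps into the space of utilities. -/

section MeasurabilityOfUtilities

/-- On a compact set mapped into `V` the distance to the complement of `V` is bounded below, and
such a bound is visible on a dense subset. The extended distance also covers `V = univ`. -/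
lemma mapsTo_open_iff {X : Type*} [TopologicalSpace X] (f : C(X, ℝ)) {K t : Set X} {V : Set ℝ}
    (hK : IsCompact K) (htK : t ⊆ K) (hKt : K ⊆ closure t) (hV : IsOpen V) :
    MapsTo f K V ↔ ∃ n : ℕ, ∀ x ∈ t, (n : ENNReal)⁻¹ ≤ Metric.infEDist (f x) Vᶜ := by
  have hc : Continuous fun x => Metric.infEDist (f x) Vᶜ :=
    Metric.continuous_infEDist.comp f.continuous
  constructor
  · intro h
    rcases K.eq_empty_or_nonempty with rfl | hne
    · exact ⟨0, fun x hx => (htK hx).elim⟩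
    · obtain ⟨x₀, hx₀, hmin⟩ := hK.exists_isMinOn hne hc.continuousOn
      have h0 : Metric.infEDist (f x₀) Vᶜ ≠ 0 := fun h0 =>
        (hV.isClosed_compl.closure_eq ▸ Metric.mem_closure_iff_infEDist_zero.2 h0 :
          f x₀ ∈ Vᶜ) (h hx₀)
      obtain ⟨n, hn⟩ := ENNReal.exists_inv_nat_lt h0
      exact ⟨n, fun x hx => hn.le.trans (hmin (htK hx))⟩
  · rintro ⟨n, hn⟩ x hx
    have h1 : (n : ENNReal)⁻¹ ≤ Metric.infEDist (f x) Vᶜ :=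
      closure_minimal (s := t) (t := {x | (n : ENNReal)⁻¹ ≤ Metric.infEDist (f x) Vᶜ}) hn
        (isClosed_le continuous_const hc) (hKt hx)
    by_contra hV'
    rw [Metric.infEDist_zero_of_mem (show f x ∈ Vᶜ from hV')] at h1
    simp at h1

/-- The subbasic sets of the compact-open topology generate the Borel σ-algebra, and each is
described by countably many evaluations on a dense subset of the compact set. -/
lemma measurable_continuousMap_of_eval {Z : Type*} [MeasurableSpace Z] {ℓ : ℕ}
    {F : Z → C(orthant ℓ, ℝ)} (h : ∀ x, Measurable fun z => F z x) : Measurable F := by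
  rw [(utilityBorelSpace ℓ).measurable_eq,
    borel_eq_generateFrom_of_subbasis ContinuousMap.compactOpen_eq]
  refine measurable_generateFrom ?_
  rintro _ ⟨K, hK, V, hV, rfl⟩
  obtain ⟨s, hs, hsd⟩ := TopologicalSpace.exists_countable_dense K
  have htc : (Subtype.val '' s : Set (orthant ℓ)).Countable := hs.image _
  have hKt : K ⊆ closure (Subtype.val '' s) := fun x hx =>
    image_closure_subset_closure_image continuous_subtype_val ⟨⟨x, hx⟩, hsd _, rfl⟩
  have : F ⁻¹' {f : C(orthant ℓ, ℝ) | MapsTo f K V} = ⋃ n : ℕ, ⋂ x ∈ (Subtype.val '' s),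
      {z | (n : ENNReal)⁻¹ ≤ Metric.infEDist (F z x) Vᶜ} := by
    ext z
    simp only [mem_preimage, mem_ofPred_eq, mem_iUnion, mem_iInter]
    exact mapsTo_open_iff (F z) hK (by rintro _ ⟨y, _, rfl⟩; exact y.2) hKt hV
  rw [this]
  exact MeasurableSet.iUnion fun n => MeasurableSet.biInter htc fun x _ =>
    measurableSet_le measurable_const (h x).infEDist

end MeasurabilityOfUtilities

/-! ### Hausdorff continuity and measurability of the aggregate. -/

section AggregateCompact

variable {T : Type*} [MeasurableSpace T] {μ : Measure T} {ℓ : ℕ}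

instance Agent.instNonempty : Nonempty (Agent ℓ) := by
  refine ⟨(0, ⟨⟨fun x => ∑ h, (x : EuclideanSpace ℝ (Fin ℓ)) h, by fun_prop⟩, fun x y hy => ?_⟩)⟩
  change ∑ h, (x : EuclideanSpace ℝ (Fin ℓ)) h <
    ∑ h, ((x : EuclideanSpace ℝ (Fin ℓ)) h + (y : EuclideanSpace ℝ (Fin ℓ)) h)
  obtain ⟨h, hh⟩ : ∃ h, (y : EuclideanSpace ℝ (Fin ℓ)) h ≠ 0 := by
    by_contra! hc
    exact hy (orthant.ext_coord hc)
  refine Finset.sum_lt_sum (fun k _ => le_add_of_nonneg_right (orthant.coord_nonneg y k))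
    ⟨h, Finset.mem_univ h, lt_add_of_pos_right _ ?_⟩
  exact lt_of_le_of_ne (orthant.coord_nonneg y h) hh.symm

lemma economyTendsto_const {d : T → Agent ℓ} (hd : Measurable d)
    (hi : Integrable (fun t => (d t).wealth) μ) {p : ℕ → PriceSimplex ℓ} {p₀ : PriceSimplex ℓ}
    (hp : Tendsto p atTop (𝓝 p₀)) :
    EconomyTendsto μ (fun _ => d) d p p₀ fun t => (d t).wealth :=
  ⟨fun _ => hd, hd, fun _ => tendsto_const_nhds, hp, Agent.continuous_wealth.measurable.comp hd,
    hi, fun _ _ => le_rfl⟩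

/-- Closedness is upper hemicontinuity for a constant economy at a constant price. The box gives
boundedness, and its corner gives an element. -/
lemma exists_nonemptyCompacts_aggregate [IsFiniteMeasure μ] {d : T → Agent ℓ} (hd : Measurable d)
    (hi : Integrable (fun t => (d t).wealth) μ) (p : PriceSimplex ℓ) :
    ∃ K : CompactSubsets ℓ, (fun x : orthant ℓ => (x : EuclideanSpace ℝ (Fin ℓ))) ''
      (K : Set (orthant ℓ)) = aggregatePreferred μ d p := by
  have hclosed : IsClosed (aggregatePreferred μ d p) := by
    refine IsSeqClosed.isClosed fun v v₀ hv hvv => ?_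
    exact (economyTendsto_const hd hi tendsto_const_nhds).mem_aggregate_of_tendsto hv hvv
  have hcomp : IsCompact (aggregatePreferred μ d p) :=
    (isCompact_closedBall (0 : EuclideanSpace ℝ (Fin ℓ)) _).of_isClosed_subset hclosed
      fun v hv => mem_closedBall_zero_iff.2 (coe_mem_orthant_of_mem_aggregate hi hv).2
  have himg : (fun x : orthant ℓ => (x : EuclideanSpace ℝ (Fin ℓ))) ''
      ((fun x : orthant ℓ => (x : EuclideanSpace ℝ (Fin ℓ))) ⁻¹' aggregatePreferred μ d p) =
        aggregatePreferred μ d p :=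
    image_preimage_eq_of_subset fun v hv =>
      ⟨⟨v, (coe_mem_orthant_of_mem_aggregate hi hv).1⟩, rfl⟩
  refine ⟨⟨⟨(fun x : orthant ℓ => (x : EuclideanSpace ℝ (Fin ℓ))) ⁻¹' aggregatePreferred μ d p,
    ?_⟩, ?_⟩, himg⟩
  · exact (orthant.isClosed ℓ).isClosedEmbedding_subtypeVal.isCompact_preimage hcomp
  · have hne : (aggregatePreferred μ d p).Nonempty := ⟨_, boxCorner_mem_aggregate hd hi p⟩
    rw [← himg] at hne
    exact hne.of_image

/-- The aggregate preferred set as a non-empty compact subset of the orthant. -/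
noncomputable def compactAggregate (μ : Measure T) (d : T → Agent ℓ) (p : PriceSimplex ℓ) :
    CompactSubsets ℓ :=
  Classical.epsilon fun K : CompactSubsets ℓ =>
    (fun x : orthant ℓ => (x : EuclideanSpace ℝ (Fin ℓ))) '' (K : Set (orthant ℓ)) =
      aggregatePreferred μ d p

lemma coe_compactAggregate [IsFiniteMeasure μ] {d : T → Agent ℓ} (hd : Measurable d)
    (hi : Integrable (fun t => (d t).wealth) μ) (p : PriceSimplex ℓ) :
    (fun x : orthant ℓ => (x : EuclideanSpace ℝ (Fin ℓ))) ''
      (compactAggregate μ d p : Set (orthant ℓ)) = aggregatePreferred μ d p :=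
  Classical.epsilon_spec (exists_nonemptyCompacts_aggregate hd hi p)

attribute [irreducible] compactAggregate

lemma mem_compactAggregate [IsFiniteMeasure μ] {d : T → Agent ℓ} (hd : Measurable d)
    (hi : Integrable (fun t => (d t).wealth) μ) {p : PriceSimplex ℓ} {x : orthant ℓ} :
    x ∈ compactAggregate μ d p ↔
      (x : EuclideanSpace ℝ (Fin ℓ)) ∈ aggregatePreferred μ d p := by
  rw [← coe_compactAggregate hd hi p, Subtype.val_injective.mem_set_image]
  rfl

lemma EconomyTendsto.tendsto_compactAggregate [IsFiniteMeasure μ] {d : ℕ → T → Agent ℓ}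
    {d₀ : T → Agent ℓ} {p : ℕ → PriceSimplex ℓ} {p₀ : PriceSimplex ℓ} {G : T → ℝ}
    (H : EconomyTendsto μ d d₀ p p₀ G) :
    Tendsto (fun n => compactAggregate μ (d n) (p n)) atTop (𝓝 (compactAggregate μ d₀ p₀)) := by
  obtain ⟨C, hC0, hC⟩ := exists_inv_minPrice_le H.tendsto_price
  have hmem : ∀ n x, x ∈ compactAggregate μ (d n) (p n) ↔ _ := fun n x =>
    mem_compactAggregate (H.measurable n) (H.integrable_wealth n)
  have hmem₀ : ∀ x, x ∈ compactAggregate μ d₀ p₀ ↔ _ := fun x =>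
    mem_compactAggregate H.measurable_limit H.integrable_wealth_limit
  refine tendsto_nonemptyCompacts
    (S := (fun x : orthant ℓ => (x : EuclideanSpace ℝ (Fin ℓ))) ⁻¹'
      Metric.closedBall 0 (ℓ * (C * ∫ t, G t ∂μ)))
    ((orthant.isClosed ℓ).isClosedEmbedding_subtypeVal.isCompact_preimage
      (isCompact_closedBall _ _)) (fun n x hx => ?_) (fun ψ hψ x x₀ hx hxx => ?_)
    fun x hx η hη => ?_
  · refine mem_closedBall_zero_iff.2
      ((coe_mem_orthant_of_mem_aggregate (H.integrable_wealth n) ((hmem n x).1 hx)).2.trans ?_)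
    refine mul_le_mul_of_nonneg_left (mul_le_mul (hC n) ?_ ?_ hC0) (Nat.cast_nonneg _)
    · exact integral_mono (H.integrable_wealth n) H.integrable_bound (H.wealth_le n)
    · exact integral_nonneg fun t => Agent.wealth_nonneg _
  · exact (hmem₀ x₀).2 ((H.comp hψ).mem_aggregate_of_tendsto
      (v := fun n => (x n : EuclideanSpace ℝ (Fin ℓ))) (fun n => (hmem _ _).1 (hx n))
      (tendsto_subtype_rng.1 hxx))
  · filter_upwards [H.eventually_exists_dist_lt ((hmem₀ x).1 hx) hη] with n ⟨w, hw, hwd⟩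
    exact ⟨⟨w, (coe_mem_orthant_of_mem_aggregate (H.integrable_wealth n) hw).1⟩,
      (hmem n _).2 hw, hwd⟩

instance compactSubsetsBorelSpace (ℓ : ℕ) : BorelSpace (CompactSubsets ℓ) := ⟨rfl⟩

/-- The agent with the endowment truncated coordinatewise at `N`. -/
def Agent.truncate (N : ℕ) (d : Agent ℓ) : Agent ℓ :=
  (orthant.mk (fun h => min ((d.1 : EuclideanSpace ℝ (Fin ℓ)) h) N) fun h =>
    le_min (orthant.coord_nonneg _ h) (Nat.cast_nonneg _), d.2)

lemma Agent.continuous_truncate (N : ℕ) : Continuous (Agent.truncate N : Agent ℓ → Agent ℓ) :=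
  (orthant.continuous_mk _ fun h => by fun_prop).prodMk continuous_snd

lemma Agent.wealth_truncate_le (N : ℕ) (d : Agent ℓ) :
    (d.truncate N).wealth ≤ d.wealth ∧ (d.truncate N).wealth ≤ ℓ * N := by
  constructor
  · exact Finset.sum_le_sum fun h _ => min_le_left _ _
  · refine (Finset.sum_le_sum fun h _ => min_le_right _ _).trans_eq ?_
    simp

lemma Agent.tendsto_truncate (d : Agent ℓ) :
    Tendsto (fun N => d.truncate N) atTop (𝓝 d) := by
  refine tendsto_const_nhds.congr' ?_
  obtain ⟨M, hM⟩ := exists_nat_ge d.wealth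
  filter_upwards [eventually_ge_atTop M] with N hN
  refine Prod.ext (orthant.ext_coord fun h => ?_) rfl
  refine (min_eq_left ?_).symm
  calc (d.1 : EuclideanSpace ℝ (Fin ℓ)) h ≤ d.wealth :=
        Finset.single_le_sum (fun k _ => orthant.coord_nonneg d.1 k) (Finset.mem_univ h)
    _ ≤ M := hM
    _ ≤ N := Nat.cast_le.2 hN

variable {Ω : Type*} [MeasurableSpace Ω]

/-- For a generator the aggregate factors through `ℕ`. Truncation supplies the constant bound `ℓ *
N`, so limits in the induction are dominated although the approximating economies need not have
integrable wealth. -/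
lemma SectionallyGenerated.measurable_compactAggregate [IsFiniteMeasure μ] {d : T × Ω → Agent ℓ}
    (hd : SectionallyGenerated d) (N : ℕ) (p : PriceSimplex ℓ) : Measurable d ∧
      Measurable fun ω => compactAggregate μ (fun t => (d (t, ω)).truncate N) p := by
  induction hd with
  | base G hG i hi =>
    constructor
    · have h1 : Measurable fun q : ℕ × T => G q.1 q.2 := measurable_from_prod_countable_right hG
      exact h1.comp ((hi.comp measurable_snd).prodMk measurable_fst)
    · exact (measurable_from_nat (f := fun n =>
        compactAggregate μ (fun t => (G n t).truncate N) p)).comp hi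
  | lim g f _ hgf ih =>
    have hf : Measurable f := measurable_of_tendsto_metrizable (fun n => (ih n).1)
      (tendsto_pi_nhds.2 hgf)
    refine ⟨hf, measurable_of_tendsto_metrizable (fun n => (ih n).2)
      (tendsto_pi_nhds.2 fun ω => ?_)⟩
    have hm := (Agent.continuous_truncate (ℓ := ℓ) N).measurable
    have H : EconomyTendsto μ (fun n t => (g n (t, ω)).truncate N)
        (fun t => (f (t, ω)).truncate N) (fun _ => p) p fun _ => (ℓ : ℝ) * N :=
      ⟨fun n => hm.comp ((ih n).1.comp measurable_prodMk_right),
        hm.comp (hf.comp measurable_prodMk_right),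
        fun t => ((Agent.continuous_truncate N).tendsto _).comp (hgf (t, ω)),
        tendsto_const_nhds, measurable_const, integrable_const _,
        fun n t => (Agent.wealth_truncate_le N _).2⟩
    exact H.tendsto_compactAggregate

/-- The truncation is removed by letting `N` tend to infinity, now with the integrable wealth itself
as bound. -/
lemma measurable_compactAggregate [IsFiniteMeasure μ] {d : T × Ω → Agent ℓ} (hd : Measurable d)
    (hi : ∀ ω, Integrable (fun t => (d (t, ω)).wealth) μ) (p : PriceSimplex ℓ) :
    Measurable fun ω => compactAggregate μ (fun t => d (t, ω)) p := by
  refine measurable_of_tendsto_metrizable (fun N =>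
    ((SectionallyGenerated.of_measurable hd).measurable_compactAggregate (μ := μ) N p).2)
    (tendsto_pi_nhds.2 fun ω => ?_)
  have hdω : Measurable fun t => d (t, ω) := hd.comp measurable_prodMk_right
  have H : EconomyTendsto μ (fun N t => (d (t, ω)).truncate N) (fun t => d (t, ω)) (fun _ => p) p
      fun t => (d (t, ω)).wealth :=
    ⟨fun N => (Agent.continuous_truncate N).measurable.comp hdω, hdω,
      fun t => Agent.tendsto_truncate _, tendsto_const_nhds,
      Agent.continuous_wealth.measurable.comp hdω, hi ω,
      fun N t => (Agent.wealth_truncate_le N _).1⟩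
  exact H.tendsto_compactAggregate

end AggregateCompact

lemma aggregatePreferredSet_eq {T Ω : Type*} [MeasurableSpace T] {ℓ : ℕ} (μ : Measure T)
    (a : T → Ω → orthant ℓ) (U : T → Ω → orthant ℓ → ℝ) (d : T × Ω → Agent ℓ)
    (ha : ∀ z, (d z).1 = a z.1 z.2) (hU : ∀ z x, (d z).2.1 x = U z.1 z.2 x) (ω : Ω)
    (p : PriceSimplex ℓ) :
    aggregatePreferredSet μ a U ω p = aggregatePreferred μ (fun t => d (t, ω)) p := by
  have h : ∀ t, preferredSet a U t ω p = (d (t, ω)).preferred p := by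
    intro t
    ext y
    simp only [Agent.preferred, preferredSet, _root_.upperSet, budgetSet, boxSet, boundVector,
      mem_inter_iff, mem_ofPred_eq, ha, hU]
  simp only [aggregatePreferredSet, aggregatePreferred, h]

theorem mainTheorem4 {T Ω : Type*} [MeasurableSpace T] [MeasurableSpace Ω]
    (μ : Measure T) [IsFiniteMeasure μ]
    (ν : Measure Ω) [IsProbabilityMeasure ν] [ν.IsComplete]
    (ℓ : ℕ) (a : T → Ω → orthant ℓ) (U : T → Ω → orthant ℓ → ℝ)
    (hA1 : AssumptionA1 μ a) (hA2 : AssumptionA2 U) (hA3 : AssumptionA3 U) :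
    ∃ Φ : Ω × PriceSimplex ℓ → CompactSubsets ℓ,
      (∀ ω p, (fun x : orthant ℓ => (x : EuclideanSpace ℝ (Fin ℓ))) ''
        (Φ (ω, p) : Set (orthant ℓ)) = aggregatePreferredSet μ a U ω p) ∧
      Measurable Φ ∧ IsCaratheodory Φ := by
  let u : T × Ω → C(orthant ℓ, ℝ) := fun z => ⟨U z.1 z.2, hA2.2 z.1 z.2⟩
  have hu : Measurable u := measurable_continuousMap_of_eval hA2.1
  let d : T × Ω → Agent ℓ := fun z => (a z.1 z.2, ⟨u z, hA3 z.1 z.2⟩)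
  have hd : Measurable d := hA1.1.prodMk (hu.subtype_mk)
  have hi : ∀ ω, Integrable (fun t => (d (t, ω)).wealth) μ := fun ω =>
    integrable_finsetSum _ fun h _ => integrable_piLp_iff.1 (hA1.2 ω).1 h
  have hdω : ∀ ω, Measurable fun t => d (t, ω) := fun ω => hd.comp measurable_prodMk_right
  have hmeas : ∀ p, Measurable fun ω => compactAggregate μ (fun t => d (t, ω)) p :=
    measurable_compactAggregate hd hi
  have hcont : ∀ ω, Continuous fun p => compactAggregate μ (fun t => d (t, ω)) p := fun ω =>
    continuous_iff_seqContinuous.2 fun p p₀ hp =>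
      (economyTendsto_const (hdω ω) (hi ω) hp).tendsto_compactAggregate
  refine ⟨fun z => compactAggregate μ (fun t => d (t, z.1)) z.2,
    fun ω p => ?_, ?_, hmeas, hcont⟩
  · rw [aggregatePreferredSet_eq μ a U d (fun _ => rfl) (fun _ _ => rfl)]
    exact coe_compactAggregate (hdω ω) (hi ω) p
  -- Continuity in the price and measurability in the state give joint measurability.
  · have hunc : Measurable (Function.uncurry fun p ω =>
        compactAggregate μ (fun t => d (t, ω)) p) :=
      measurable_uncurry_of_continuous_of_measurable hcont hmeas
    have hswap : Measurable fun z : Ω × PriceSimplex ℓ => (z.2, z.1) := measurable_swap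
    exact hunc.comp hswap
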